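/- Let $n=\rho+\delta$ with integers $\rho\ge 1$, $\delta\ge 0$, and let $\mathbf x=(x_1\le\dots\le x_n)$ and $\mathbf y=(y_1\le\dots\le y_n)$ be real vectors; if $n=1$, assume also $x_1\ne y_1$. For $\mathbf b\in\mathbb R^{k+1}$, $\mathbf a\in\mathbb R^{k}$ write $\mathbf b\succ\mathbf a$ if $b_1\le a_1\le b_2\le\dots\le a_k\le b_{k+1}$. The double cone is the set $$\mathcal C^{(n)}_{\mathbf x,\mathbf y}\subset\mathbb R^{n(n-1)}$$ of all $(\mathbf x^{(n-1)},\dots,\mathbf x^{(1)},\mathbf y^{(n-1)},\dots,\mathbf y^{(1)})$ with $\mathbf x^{(k)},\mathbf y^{(k)}\in\mathbb R^k$, such that, with $\mathbf x^{(n)}=\mathbf x$ and $\mathbf y^{(n)}=\mathbf y$, $$\mathbf x\succ\mathbf x^{(n-1)}\succ\dots\succ\mathbf x^{(1)},\qquad \mathbf y\succ\mathbf y^{(n-1)}\succ\dots\succ\mathbf y^{(1)},\qquad \max \mathbf y^{(i)}\le\min \mathbf x^{(\rho-i+1)}\quad(1\le i\le\rho).$$ Then its Lebesgue volume is finite (for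 $n=1$ the volume is $1$ or $0$ according to whether the condition $y_1\le x_1$ holds or fails), and: (i) if $n=\rho$, then $$\mathrm{Vol}(\mathcal C^{(\rho)}_{\mathbf x,\mathbf y})=\det\left[\frac{(x_i-y_j)^{\rho-1}}{(\rho-1)!}\mathbf 1_{x_i>y_j}\right]_{1\le i,j\le\rho};$$ (ii) for every $n=\rho+\delta\ge\rho$ (including $n=\rho$), if the $x_i$ are distinct, then for every $\beta\in\mathbb R$ $$\mathrm{Vol}(\mathcal C^{(n)}_{\mathbf x,\mathbf y})=\Gamma^{(n)}_{\mathbf x\mathbf y},$$ where $\Gamma^{(n)}_{\mathbf x\mathbf y}$ is given by either of the following two expressions (the equality holds with each of them). First expression. Put $\mathbb H^m(z)=\mathbf 1_{z\ge0}\,z^{m-1}/(m-1)!$, $R(z)=\prod_{k}(z-x_k+\beta)$, $\hat R_{ij}(z)=\prod_{k\ne i,j}(z-x_k+\beta)$, and $$\mathcal L_{ij}=(-1)^\delta\,\delta\,\frac{\hat R_{ij}^{(\delta-1)}(x_i-\beta)}{R'(x_j-\beta)}\ (i\ne j),\qquad \mathcal L_{ii}=\frac{(-1)^\delta}{\delta+1}\,\frac{R^{(\delta+1)}(x_i-\beta)}{R'(x_i-\beta)},$$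 where the off-diagonal entries are $0$ if $\delta=0$. Then $$\Gamma^{(n)}_{\mathbf x\mathbf y}=\det\left[\frac{(y_j-x_i)^{n-1}}{(n-1)!}-\sum_{k=1}^n\mathcal L_{ik}\,\mathbb H^{n+\delta}(y_j-x_k)\right]_{1\le i,j\le n}.$$ Second expression. Let $H_m$ be the Hermite polynomials with $e^{2zw-w^2}=\sum_{m\ge0}H_m(z)w^m/m!$, and put $\widetilde H_m=H_m/m!$ and $P_m(z)=\mathrm i^{-m}\widetilde H_m(\mathrm i z)$. Let $f_0(\mathbf x,y),\dots,f_{n-1}(\mathbf x,y)$ be the solution of the linear system $$\sum_{k=0}^{n-1}\widetilde H_{n-1-k}(-x_i)\,f_k(\mathbf x,y)=-\mathbb H^{n+\delta}(2(y-x_i)),\qquad 1\le i\le n,$$ given by Cramer's rule. With $\mathbf x-\beta=(x_1-\beta,\dots,x_n-\beta)$, $$\Gamma^{(n)}_{\mathbf x\mathbf y}=\frac{\det\big(\widetilde H_{n-j}(\beta-x_i)\big)_{1\le i,j\le n}}{2^{n(n-1)}}\ \det\begin{pmatrix}P_i(y_j-\beta)\big|_{0\le i\le\delta-1}\\[2pt]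 P_{\delta+i}(y_j-\beta)+f_i(\mathbf x-\beta,y_j-\beta)\big|_{0\le i\le\rho-1}\end{pmatrix}_{1\le j\le n}.$$ -/

import Mathlib

open MeasureTheory Polynomial

noncomputable section

namespace DoubleCone

/-! ### The double cone -/

/-- `a ∈ ℝ^k` interlaces with `b ∈ ℝ^(k+1)` (written `b ≻ a`):
`b₁ ≤ a₁ ≤ b₂ ≤ a₂ ≤ ⋯ ≤ a_k ≤ b_{k+1}`. -/
def Interlaces {k : ℕ} (b : Fin (k + 1) → ℝ) (a : Fin k → ℝ) : Prop :=
  ∀ i : Fin k, b i.castSucc ≤ a i ∧ a i ≤ b i.succ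

/-- The intermediate vectors: a vector `u⁽ᵏ⁾ ∈ ℝ^k` for each level `k < n`. Level `0` is the
one-point space `ℝ^0`, so that this is `ℝ^(n(n-1)/2)`, with Lebesgue measure as its `volume`. -/
abbrev Levels (n : ℕ) : Type := (k : Fin n) → Fin k → ℝ

/-- The full sequence `u⁽¹⁾, …, u⁽ⁿ⁻¹⁾, u⁽ⁿ⁾ = x`, for given top vector `x ∈ ℝ^n`. -/
def tower {n : ℕ} (x : Fin n → ℝ) (u : Levels n) : (k : Fin (n + 1)) → Fin k → ℝ :=
  Fin.snoc (α := fun k : Fin (n + 1) => Fin k → ℝ) u x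

/-- The cone `x ≻ u⁽ⁿ⁻¹⁾ ≻ ⋯ ≻ u⁽¹⁾` over `x`. -/
def singleCone {n : ℕ} (x : Fin n → ℝ) : Set (Levels n) :=
  {u | ∀ k : Fin n, Interlaces (tower x u k.succ) (tower x u k.castSucc)}

/-- The double cone over `x, y ∈ ℝ^n`: pairs of interlacing sequences `x ≻ x⁽ⁿ⁻¹⁾ ≻ ⋯ ≻ x⁽¹⁾` and
`y ≻ y⁽ⁿ⁻¹⁾ ≻ ⋯ ≻ y⁽¹⁾` with `max y⁽ⁱ⁾ ≤ min x⁽ʲ⁾` whenever `i + j = ρ + 1`, `1 ≤ i ≤ ρ`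
(for `i = 0` or `j = 0` the last condition is vacuous). Here `x⁽ⁿ⁾ = x` and `y⁽ⁿ⁾ = y`. -/
def cone {n : ℕ} (ρ : ℕ) (x y : Fin n → ℝ) : Set (Levels n × Levels n) :=
  {p | p.1 ∈ singleCone x ∧ p.2 ∈ singleCone y ∧
    ∀ i j : Fin (n + 1), (i : ℕ) + (j : ℕ) = ρ + 1 →
      ∀ (a : Fin i) (b : Fin j), tower y p.2 i a ≤ tower x p.1 j b}

/-! ### The determinant with the matrix `ℒ` -/

/-- `ℍ^m(z) = 1_{z ≥ 0} z^(m-1) / (m-1)!`, for `m ≥ 1`. -/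
def heaviside (m : ℕ) (z : ℝ) : ℝ :=
  if 0 ≤ z then z ^ (m - 1) / ((m - 1).factorial : ℝ) else 0

/-- `R(z) = ∏_k (z - x_k + β)`. -/
def polyR {n : ℕ} (β : ℝ) (x : Fin n → ℝ) : ℝ[X] :=
  ∏ k, (X - C (x k) + C β)

/-- `R̂_ij(z) = ∏_{k ≠ i, j} (z - x_k + β)`. -/
def polyRhat {n : ℕ} (β : ℝ) (x : Fin n → ℝ) (i j : Fin n) : ℝ[X] :=
  ∏ k ∈ Finset.univ.filter (fun k => k ≠ i ∧ k ≠ j), (X - C (x k) + C β)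

/-- The matrix `ℒ`. For `δ = 0` the off-diagonal entries vanish because of the factor `δ`. -/
def matL {n : ℕ} (δ : ℕ) (β : ℝ) (x : Fin n → ℝ) : Matrix (Fin n) (Fin n) ℝ :=
  Matrix.of fun i j =>
    if i = j then
      (-1) ^ δ / ((δ : ℝ) + 1) * ((derivative^[δ + 1] (polyR β x)).eval (x i - β) /
        (derivative (polyR β x)).eval (x i - β))
    else
      (-1) ^ δ * (δ : ℝ) * ((derivative^[δ - 1] (polyRhat β x i j)).eval (x i - β) /
        (derivative (polyR β x)).eval (x j - β))

/-- `Γ_{xy} = det [(y_j - x_i)^(n-1)/(n-1)! - ∑_k ℒ_ik ℍ^(n+δ)(y_j - x_k)]`. -/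
def gammaL {n : ℕ} (δ : ℕ) (β : ℝ) (x y : Fin n → ℝ) : ℝ :=
  (Matrix.of fun i j : Fin n =>
    (y j - x i) ^ (n - 1) / ((n - 1).factorial : ℝ)
      - ∑ k, matL δ β x i k * heaviside (n + δ) (y j - x k)).det

/-! ### The determinant with Hermite polynomials -/

/-- The (physicists') Hermite polynomials: `H_0 = 1`, `H_{m+1} = 2 z H_m - H_m'`. -/
def hermiteH : ℕ → ℤ[X]
  | 0 => 1
  | m + 1 => 2 * X * hermiteH m - derivative (hermiteH m)

/-- `H̃_m(z) = H_m(z) / m!`, for real or complex `z`. -/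
def hermiteT {K : Type*} [Field K] (m : ℕ) (z : K) : K :=
  aeval z (hermiteH m) / (m.factorial : K)

/-- `P_m(z) = i^(-m) H̃_m(i z)` for real `z`; this number is real, see `ofReal_hermiteP`. -/
def hermiteP (m : ℕ) (z : ℝ) : ℝ :=
  (hermiteT m (Complex.I * (z : ℂ)) / Complex.I ^ m).re

theorem hermiteH_comp_neg (m : ℕ) : (hermiteH m).comp (-X) = (-1) ^ m * hermiteH m := by
  induction m with
  | zero => simp [hermiteH]
  | succ m ih =>
    have h : (derivative (hermiteH m)).comp (-X) = (-1) ^ (m + 1) * derivative (hermiteH m) := by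
      have h1 := congrArg derivative ih
      have h2 : derivative ((-1 : ℤ[X]) ^ m) = 0 := by
        have : ((-1 : ℤ[X]) ^ m) = C ((-1) ^ m) := by simp
        rw [this, derivative_C]
      rw [derivative_comp, derivative_mul, h2] at h1
      simp only [derivative_neg, derivative_X, zero_mul, zero_add] at h1
      rw [pow_succ]
      linear_combination -h1
    simp only [hermiteH, sub_comp, mul_comp, X_comp, ih, h]
    have : (2 : ℤ[X]).comp (-X) = 2 := by simp
    rw [this]
    ring

theorem ofReal_hermiteP (m : ℕ) (z : ℝ) :
    (hermiteP m z : ℂ) = hermiteT m (Complex.I * (z : ℂ)) / Complex.I ^ m := by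
  refine Complex.conj_eq_iff_re.mp ?_
  have key : (starRingEnd ℂ) (aeval (Complex.I * (z : ℂ)) (hermiteH m))
      = (-1) ^ m * aeval (Complex.I * (z : ℂ)) (hermiteH m) := by
    have h1 : (starRingEnd ℂ) (aeval (Complex.I * (z : ℂ)) (hermiteH m))
        = aeval (-(Complex.I * (z : ℂ))) (hermiteH m) := by
      have h2 : (starRingEnd ℂ) (Complex.I * (z : ℂ)) = -(Complex.I * (z : ℂ)) := by simp
      rw [← h2, aeval_def, aeval_def, hom_eval₂]
      congr 1
      exact RingHom.ext_int _ _
    have h3 := congrArg (aeval (Complex.I * (z : ℂ))) (hermiteH_comp_neg m)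
    rw [aeval_comp] at h3
    simpa [h1] using h3
  have hI : (-Complex.I) ^ m = (-1) ^ m * Complex.I ^ m := by rw [← neg_one_mul, mul_pow]
  have hm : ((-1 : ℂ)) ^ m ≠ 0 := pow_ne_zero _ (by norm_num)
  simp only [hermiteT, map_div₀, map_pow, Complex.conj_I, map_natCast, key, hI]
  field_simp

/-- The matrix `(H̃_{n-j}(-x_i))_{1 ≤ i, j ≤ n}`. -/
def hermiteMatrix {n : ℕ} (x : Fin n → ℝ) : Matrix (Fin n) (Fin n) ℝ :=
  Matrix.of fun i j => hermiteT (n - 1 - (j : ℕ)) (-x i)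

/-- The solution `f_0(x, y), …, f_{n-1}(x, y)`, by Cramer's rule, of the linear system
`∑_k H̃_{n-1-k}(-x_i) f_k(x, y) = -ℍ^(n+δ)(2(y - x_i))`, `1 ≤ i ≤ n`. -/
def cramerF {n : ℕ} (δ : ℕ) (x : Fin n → ℝ) (y : ℝ) (k : Fin n) : ℝ :=
  -(hermiteMatrix x).det⁻¹ *
    ((hermiteMatrix x).updateCol k fun i => heaviside (n + δ) (2 * (y - x i))).det

/-- `Γ_{xy}` as `2^(-n(n-1)) det (H̃_{n-j}(β - x_i))` times the determinant of the matrix with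
columns indexed by `1 ≤ j ≤ n`, with first `δ` rows `P_i(y_j - β)`, `0 ≤ i < δ`, and other rows
`P_{δ+i}(y_j - β) + f_i(x - β, y_j - β)`, `0 ≤ i < n - δ`. -/
def gammaH {n : ℕ} (δ : ℕ) (β : ℝ) (x y : Fin n → ℝ) : ℝ :=
  (hermiteMatrix fun i => x i - β).det / 2 ^ (n * (n - 1)) *
    (Matrix.of fun i j : Fin n =>
      hermiteP i (y j - β) +
        if δ ≤ (i : ℕ) then
          cramerF δ (fun l => x l - β) (y j - β) ⟨(i : ℕ) - δ, (Nat.sub_le _ _).trans_lt i.isLt⟩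
        else 0).det

end DoubleCone

end

/-!
The volume of the double cone is computed as an iterated integral over interlacing vectors, every
step of which turns a determinant into a determinant.

The basic fact is `integral_interlacingBox_det_eq`: the vectors `a` interlacing with `b` form a box,
over which `det [f_i(a_j)]` integrates to `det [∫ f_i over (b_j, b_{j+1})]`; with primitives `F_i`
this is the determinant of `[F_i(b_j)]` with an additional row of ones.

*The case `n = ρ`.* The vectors `z⁽ⁱ⁾ = (y⁽ⁱ⁾, x⁽ᵖ⁻ⁱ⁾)`, with `p = ρ`, all have length `ρ`, and the
conditions that define the double cone say precisely that `x = z⁽⁰⁾, z⁽¹⁾, …, z⁽ᵖ⁾ = y` is a chain in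
which `z⁽ⁱ⁺¹⁾_b ≤ z⁽ⁱ⁾_b ≤ z⁽ⁱ⁺¹⁾_{b+1}` (`volume_cone_eq_volume_chainSet`). The indicator function
of one such relation is `det [1_{x_i > y_j}]` off a null set (`det_truncPow_one`), and each further
vector in the chain raises by one the order of the truncated powers (`volume_chainSet`).

*The general case.* The upper `δ` levels on both sides are decoupled from each other, so the volume
is the integral of the determinant for `ρ` over `δ` levels in `x` and `δ` levels in `y`, in either
order (`volume_cone_eq_lintegralChain`). Integrating in `x` first adds `δ` rows of polynomials in
`x` of degrees `δ - 1, …, 0`. For distinct `x_i`, multiplication by the inverse of the matrix `Q` of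
the values at `x_i` of polynomials of degrees `n - 1, …, 0` reduces the determinant to size `ρ` again
(`det_eq_det_mul_det_of_rows`), and then the integration in `y` adds `δ` rows of polynomials in `y`.
All polynomials are taken from an Appell pair `(p, q)`, that is `p_m' = κ p_{m-1}`,
`q_m' = -κ q_{m-1}` and `∑ p_a(y) q_{m-a}(x) = (κ (y - x))^m / m!`; by the last relation row
operations bring the result into the form `det Q * det [p_i(y_j) + f_{i-δ}(y_j)]`, where `f` solves
the linear system with matrix `Q` and right hand side `-ℍ(κ (y - x_i))`, and `f_{i-δ}` stands for
`0` if `i < δ` (`volume_cone_eq_det_appell`).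

The pair `(P_m, H̃_m(-x))` with `κ = 2` gives the expression with Hermite polynomials. The pair of
the normalized powers with `κ = 1` gives the other one, after multiplying the two determinants,
because `ℒ` is the matrix of `(-d/dz)^δ` in the Lagrange basis (`matL_eq`), which acts on the columns
of `Q` as a shift (`matL_eq_mul`).
-/

noncomputable section

namespace DoubleCone

/-! ### Determinants integrated over interlacing vectors -/

/-- The box of all vectors interlacing with `b`. -/
def interlacingBox {k : ℕ} (b : Fin (k + 1) → ℝ) : Set (Fin k → ℝ) :=
  Set.univ.pi fun i => Set.Icc (b i.castSucc) (b i.succ)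

theorem mem_interlacingBox {k : ℕ} {b : Fin (k + 1) → ℝ} {a : Fin k → ℝ} :
    a ∈ interlacingBox b ↔ Interlaces b a := by
  simp only [interlacingBox, Interlaces, Set.mem_univ_pi, Set.mem_Icc]

theorem measurableSet_interlacingBox {k : ℕ} (b : Fin (k + 1) → ℝ) :
    MeasurableSet (interlacingBox b) :=
  MeasurableSet.univ_pi fun _ => measurableSet_Icc

theorem monotone_of_mem_interlacingBox {k : ℕ} {b : Fin (k + 1) → ℝ} {a : Fin k → ℝ}
    (h : a ∈ interlacingBox b) : Monotone a := by
  rw [mem_interlacingBox] at h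
  cases k with
  | zero => exact fun i => i.elim0
  | succ k =>
    refine Fin.monotone_iff_le_succ.2 fun i => (h i.castSucc).2.trans ?_
    simpa using (h i.succ).1

/-- By multilinearity and Fubini, a determinant whose columns depend on one variable each is
integrated over a box entrywise. -/
theorem integral_interlacingBox_det {k : ℕ} {b : Fin (k + 1) → ℝ} (hb : Monotone b)
    (f : Fin k → ℝ → ℝ) (hf : ∀ i u v, IntervalIntegrable (f i) volume u v) :
    IntegrableOn (fun a : Fin k → ℝ => (Matrix.of fun i j => f i (a j)).det) (interlacingBox b) ∧
    ∫ a in interlacingBox b, (Matrix.of fun i j => f i (a j)).det =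
      (Matrix.of fun i j : Fin k => ∫ t in (b j.castSucc)..(b j.succ), f i t).det := by
  have hle : ∀ j : Fin k, b j.castSucc ≤ b j.succ := fun j => hb (Fin.castSucc_lt_succ).le
  have hm : (volume : Measure (Fin k → ℝ)).restrict (interlacingBox b) =
      Measure.pi fun j : Fin k => volume.restrict (Set.Icc (b j.castSucc) (b j.succ)) := by
    rw [interlacingBox, volume_pi, Measure.restrict_pi_pi]
  have hint : ∀ i j, Integrable (f i) (volume.restrict (Set.Icc (b (Fin.castSucc j)) (b j.succ))) := by
    intro i j
    exact (intervalIntegrable_iff_integrableOn_Icc_of_le (hle j)).1 (hf i _ _)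
  have hp : ∀ σ : Equiv.Perm (Fin k), Integrable (fun a : Fin k → ℝ => ∏ j, f (σ j) (a j))
      (Measure.pi fun j : Fin k => volume.restrict (Set.Icc (b j.castSucc) (b j.succ))) :=
    fun σ => Integrable.fintype_prod_dep fun j => hint (σ j) j
  simp only [Matrix.det_apply', Matrix.of_apply]
  rw [IntegrableOn, hm]
  refine ⟨integrable_finsetSum _ fun σ _ => (hp σ).const_mul _, ?_⟩
  rw [integral_finsetSum _ fun σ _ => (hp σ).const_mul _]
  refine Finset.sum_congr rfl fun σ _ => ?_
  rw [integral_const_mul, integral_fintype_prod_eq_prod]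
  congr 1
  refine Finset.prod_congr rfl fun j _ => ?_
  rw [intervalIntegral.integral_of_le (hle j), integral_Icc_eq_integral_Ioc]

/-- A determinant with a row of ones is, up to sign, the determinant of the differences of
consecutive columns in the other rows. -/
theorem det_eq_of_row_eq_one {k : ℕ} (M : Matrix (Fin (k + 1)) (Fin (k + 1)) ℝ) (r : Fin (k + 1))
    (hr : ∀ j, M r j = 1) :
    M.det = (-1) ^ (r : ℕ) * (Matrix.of fun i j : Fin k =>
      M (r.succAbove i) j.succ - M (r.succAbove i) j.castSucc).det := by
  let B : Matrix (Fin (k + 1)) (Fin (k + 1)) ℝ :=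
    Matrix.of fun i => Fin.cons (M i 0) fun j => M i j.succ - M i j.castSucc
  have hB : M.det = B.det :=
    Matrix.det_eq_of_forall_col_eq_smul_add_pred (fun _ => 1) (by simp [B]) (by simp [B])
  rw [hB, Matrix.det_succ_row B r, Fin.sum_univ_succ, Finset.sum_eq_zero, add_zero]
  · simp [B, hr, Matrix.submatrix]
  · intro j _
    simp [B, hr]

/-- Integrating a determinant over the vectors interlacing with `b` produces a determinant with
one more row, a row of ones, in position `r`. -/
theorem integral_interlacingBox_det_eq {k : ℕ} {b : Fin (k + 1) → ℝ} (hb : Monotone b) (c : ℝ)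
    (r : Fin (k + 1)) (f : Fin k → ℝ → ℝ) (F : Fin (k + 1) → ℝ → ℝ)
    (hf : ∀ i u v, IntervalIntegrable (f i) volume u v)
    (hr : ∀ t, F r t = 1)
    (hF : ∀ i u v, c * ∫ t in u..v, f i t = F (r.succAbove i) v - F (r.succAbove i) u) :
    c ^ k * ∫ a in interlacingBox b, (Matrix.of fun i j => f i (a j)).det =
      (-1) ^ (r : ℕ) * (Matrix.of fun i j => F i (b j)).det := by
  rw [(integral_interlacingBox_det hb f hf).2, det_eq_of_row_eq_one _ r (by simp [hr]),
    ← mul_assoc, ← mul_pow]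
  simp only [mul_neg, mul_one, neg_neg, one_pow, one_mul, Matrix.of_apply, ← hF]
  have := Matrix.det_smul (Matrix.of fun i j : Fin k => ∫ t in (b j.castSucc)..(b j.succ), f i t) c
  rw [Fintype.card_fin] at this
  rw [← this]
  rfl

/-- The truncated power `z ↦ 1_{z > 0} z^(m-1) / (m-1)!`. -/
def truncPow (m : ℕ) (z : ℝ) : ℝ :=
  if 0 < z then z ^ (m - 1) / ((m - 1).factorial : ℝ) else 0

theorem truncPow_of_nonpos (m : ℕ) {z : ℝ} (hz : z ≤ 0) : truncPow m z = 0 :=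
  if_neg hz.not_gt

theorem truncPow_mul (m : ℕ) {c : ℝ} (hc : 0 < c) (z : ℝ) :
    truncPow m (c * z) = c ^ (m - 1) * truncPow m z := by
  simp only [truncPow, mul_pos_iff_of_pos_left hc, mul_pow]
  split_ifs <;> ring

/-- The part of a power that the Heaviside function removes is a truncated power. -/
theorem pow_sub_heaviside (m : ℕ) (z : ℝ) :
    z ^ (m - 1) / ((m - 1).factorial : ℝ) - heaviside m z = (-1) ^ (m - 1) * truncPow m (-z) := by
  rcases lt_or_ge z 0 with h | h
  · rw [heaviside, if_neg h.not_ge, truncPow, if_pos (by linarith), ← mul_div_assoc, ← mul_pow]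
    simp
  · rw [heaviside, if_pos h, truncPow_of_nonpos m (by linarith)]
    simp

theorem continuous_truncPow (m : ℕ) : Continuous (truncPow (m + 2)) := by
  have : truncPow (m + 2) = fun z => max z 0 ^ (m + 1) / ((m + 1).factorial : ℝ) := by
    ext z
    rcases lt_or_ge 0 z with h | h
    · simp [truncPow, h, max_eq_left h.le]
    · simp [truncPow, h.not_gt, max_eq_right h]
  rw [this]
  fun_prop

theorem measurable_truncPow (m : ℕ) : Measurable (truncPow m) :=
  Measurable.ite measurableSet_Ioi (by fun_prop) measurable_const

theorem monotone_truncPow (m : ℕ) : Monotone (truncPow m) := by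
  intro u v huv
  rcases lt_or_ge 0 u with h | h
  · rw [truncPow, truncPow, if_pos h, if_pos (h.trans_le huv)]
    gcongr
  · rw [truncPow_of_nonpos m h, truncPow]
    split_ifs with hv
    · positivity
    · exact le_rfl

theorem integral_truncPow (m : ℕ) (u v : ℝ) :
    ∫ t in u..v, truncPow (m + 1) t = truncPow (m + 2) v - truncPow (m + 2) u := by
  refine integral_eq_of_hasDerivAt_off_countable (truncPow (m + 2)) _ (s := {0})
    (Set.countable_singleton _) (continuous_truncPow m).continuousOn ?_
    (monotone_truncPow _).intervalIntegrable
  rintro z ⟨-, hz⟩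
  rcases lt_or_gt_of_ne (show z ≠ 0 from hz) with h | h
  · rw [truncPow_of_nonpos _ h.le]
    refine (hasDerivAt_const z (0 : ℝ)).congr_of_eventuallyEq ?_
    filter_upwards [eventually_lt_nhds h] with w hw using truncPow_of_nonpos _ hw.le
  · have h1 : HasDerivAt (fun w : ℝ => w ^ (m + 1) / ((m + 1).factorial : ℝ))
        (truncPow (m + 1) z) z := by
      rw [truncPow, if_pos h]
      refine ((hasDerivAt_pow (m + 1) z).div_const ((m + 1).factorial : ℝ)).congr_deriv ?_
      rw [Nat.factorial_succ]
      push_cast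
      field_simp
    refine h1.congr_of_eventuallyEq ?_
    filter_upwards [eventually_gt_nhds h] with w hw
    simp [truncPow, hw]

theorem integral_truncPow_affine (m : ℕ) (c d : ℝ) (u v : ℝ) :
    c * ∫ t in u..v, truncPow (m + 1) (c * t + d) =
      truncPow (m + 2) (c * v + d) - truncPow (m + 2) (c * u + d) := by
  rw [intervalIntegral.mul_integral_comp_mul_add, integral_truncPow]

/-! ### Chains of interlacing vectors of constant length -/

/-- `z` interlaces with `x`, both of the same length: `z₁ ≤ x₁ ≤ z₂ ≤ x₂ ≤ ⋯ ≤ z_r ≤ x_r`. -/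
def ShiftInterlaces {r : ℕ} (x z : Fin r → ℝ) : Prop :=
  (∀ b, z b ≤ x b) ∧ ∀ a b : Fin r, (b : ℕ) = a + 1 → x a ≤ z b

/-- The chains of `m` vectors of constant length leading from `x` to `y`, each one interlacing
with the preceding one. -/
def chainSet {r : ℕ} (m : ℕ) (x y : Fin r → ℝ) : Set (Fin m → Fin r → ℝ) :=
  {z | ∀ i : Fin (m + 1), ShiftInterlaces
    (Fin.cons (α := fun _ => Fin r → ℝ) x z i) (Fin.snoc (α := fun _ => Fin r → ℝ) z y i)}

theorem cons_mem_chainSet {r m : ℕ} {x y z₀ : Fin r → ℝ} {z : Fin m → Fin r → ℝ} :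
    Fin.cons (α := fun _ => Fin r → ℝ) z₀ z ∈ chainSet (m + 1) x y ↔
      ShiftInterlaces x z₀ ∧ z ∈ chainSet m z₀ y := by
  simp only [chainSet, Set.mem_ofPred_eq, Fin.forall_fin_succ (n := m + 1), Fin.cons_zero,
    Fin.cons_succ, ← Fin.cons_snoc_eq_snoc_cons]

theorem isClosed_shiftInterlaces {r : ℕ} {X : Type*} [TopologicalSpace X] {f g : X → Fin r → ℝ}
    (hf : Continuous f) (hg : Continuous g) : IsClosed {p | ShiftInterlaces (f p) (g p)} := by
  simp only [ShiftInterlaces, Set.ofPred_and, Set.ofPred_forall]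
  refine IsClosed.inter (isClosed_iInter fun b => isClosed_le (by fun_prop) (by fun_prop)) ?_
  exact isClosed_iInter fun a => isClosed_iInter fun b => isClosed_iInter fun _ =>
    isClosed_le (by fun_prop) (by fun_prop)

theorem measurableSet_shiftInterlaces {r : ℕ} (x : Fin r → ℝ) :
    MeasurableSet {z | ShiftInterlaces x z} :=
  (isClosed_shiftInterlaces continuous_const continuous_id).measurableSet

theorem measurableSet_chainSet {r m : ℕ} (x y : Fin r → ℝ) : MeasurableSet (chainSet m x y) := by
  refine IsClosed.measurableSet ?_
  simp only [chainSet, Set.ofPred_forall]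
  exact isClosed_iInter fun i => isClosed_shiftInterlaces (by fun_prop) (by fun_prop)

theorem volume_chainSet_succ {r m : ℕ} (x y : Fin r → ℝ) :
    volume (chainSet (m + 1) x y) =
      ∫⁻ z₀ in {z₀ | ShiftInterlaces x z₀}, volume (chainSet m z₀ y) := by
  let e := (MeasurableEquiv.piFinSuccAbove (fun _ : Fin (m + 1) => Fin r → ℝ) 0).symm
  have he : MeasurePreserving e volume volume :=
    (volume_preserving_piFinSuccAbove (fun _ : Fin (m + 1) => Fin r → ℝ) 0).symm
  have happ : ∀ p, e p = Fin.cons (α := fun _ => Fin r → ℝ) p.1 p.2 := fun p => by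
    simp [e, MeasurableEquiv.piFinSuccAbove]
    rfl
  rw [← he.measure_preimage_equiv, Measure.volume_eq_prod,
    Measure.prod_apply (e.measurable (measurableSet_chainSet x y)),
    ← lintegral_indicator (measurableSet_shiftInterlaces x)]
  refine lintegral_congr fun z₀ => ?_
  by_cases h : ShiftInterlaces x z₀
  · rw [Set.indicator_of_mem (by exact h)]
    congr 1
    ext z
    simp [happ, cons_mem_chainSet, h]
  · rw [Set.indicator_of_notMem (by exact h)]
    convert measure_empty (μ := (volume : Measure (Fin m → Fin r → ℝ)))
    ext z
    simp [happ, cons_mem_chainSet, h]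

theorem strictMono_perm_eq_one {n : ℕ} (σ : Equiv.Perm (Fin n)) (h : StrictMono σ) : σ = 1 := by
  have : h.orderIsoOfSurjective σ σ.surjective = OrderIso.refl _ := Subsingleton.elim _ _
  ext i
  have := DFunLike.congr_fun this i
  simpa using congrArg Fin.val this

open Classical in
/-- The determinant of the matrix with entries `1_{y_i < x_j}` detects interlacing: after
subtracting from each column the preceding one, only the identity permutation can contribute. -/
theorem det_truncPow_one {k : ℕ} {x y : Fin (k + 1) → ℝ} (hx : Monotone x) (hy : Monotone y)
    (hxy : ∀ i j, x i ≠ y j) :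
    (Matrix.of fun i j => truncPow 1 (x j - y i)).det = if ShiftInterlaces x y then 1 else 0 := by
  -- Entry `(i, j)` of `B` records whether `y_i` lies between `x_{j-1}` and `x_j`.
  let B : Matrix (Fin (k + 1)) (Fin (k + 1)) ℝ := Matrix.of fun i =>
    Fin.cons (if y i < x 0 then 1 else 0)
      fun j : Fin k => if x j.castSucc ≤ y i ∧ y i < x j.succ then 1 else 0
  have hB : (Matrix.of fun i j => truncPow 1 (x j - y i)).det = B.det := by
    refine Matrix.det_eq_of_forall_col_eq_smul_add_pred (fun _ => 1) (by simp [B, truncPow]) ?_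
    intro i j
    have : x j.castSucc ≤ x j.succ := hx Fin.castSucc_lt_succ.le
    simp only [truncPow, Matrix.of_apply, B, Fin.cons_succ, sub_pos]
    split_ifs <;> first | (norm_num; done) | (exfalso; grind)
  have hlt : ∀ i j, B i j ≠ 0 → y i < x j := by
    intro i j
    refine Fin.cases ?_ (fun j => ?_) j
    · simp [B]
    · simp +contextual [B]
  have hle : ∀ (i) (j : Fin k), B i j.succ ≠ 0 → x j.castSucc ≤ y i := by
    intro i j
    simp +contextual [B]
  rw [hB, Matrix.det_apply', Finset.sum_eq_single 1]
  · split_ifs with h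
    · simp only [Equiv.Perm.sign_one, Units.val_one, Int.cast_one, Equiv.Perm.coe_one, id_eq,
        one_mul]
      refine Finset.prod_eq_one fun i _ => ?_
      refine Fin.cases ?_ (fun i => ?_) i
      · simpa [B] using lt_of_le_of_ne (h.1 0) (hxy 0 0).symm
      · simpa [B] using ⟨h.2 i.castSucc i.succ (by simp),
          lt_of_le_of_ne (h.1 i.succ) (hxy _ _).symm⟩
    · by_contra hne
      apply h
      have hne' : ∀ i, B i i ≠ 0 := fun i =>
        Finset.prod_ne_zero_iff.1 (right_ne_zero_of_mul hne) i (Finset.mem_univ i)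
      refine ⟨fun b => (hlt b b (hne' b)).le, fun a b hab => ?_⟩
      obtain ⟨b, rfl⟩ := Fin.exists_succ_eq.2 (show b ≠ 0 by rintro rfl; simp at hab)
      have : a = b.castSucc := by ext; simpa using hab.symm
      rw [this]
      exact hle _ _ (hne' _)
  · intro σ _ hσ
    by_contra hne
    have hne' : ∀ i, B (σ i) i ≠ 0 := fun i =>
      Finset.prod_ne_zero_iff.1 (right_ne_zero_of_mul hne) i (Finset.mem_univ i)
    refine hσ (strictMono_perm_eq_one σ (Fin.strictMono_iff_lt_succ.2 fun i => ?_))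
    by_contra hcon
    exact absurd ((hlt _ _ (hne' i.castSucc)).trans_le (hle _ _ (hne' i.succ)))
      (hy (not_lt.1 hcon)).not_gt
  · simp

/-- Passage from integrals of a real function to integrals in `[0, ∞]`. The sign of the integral is
part of the conclusion, so that the next integration can be treated in the same way. -/
theorem lintegral_interlacingBox_ofReal {k : ℕ} {b : Fin (k + 1) → ℝ} {D : (Fin k → ℝ) → ℝ} {I : ℝ}
    (hD : IntegrableOn D (interlacingBox b)) (hI : ∫ a in interlacingBox b, D a = I)
    {g : (Fin k → ℝ) → ENNReal}
    (hg : ∀ᵐ a, a ∈ interlacingBox b → 0 ≤ D a ∧ g a = ENNReal.ofReal (D a)) :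
    0 ≤ I ∧ ∫⁻ a in interlacingBox b, g a = ENNReal.ofReal I := by
  have hg' : ∀ᵐ a ∂volume.restrict (interlacingBox b), 0 ≤ D a ∧ g a = ENNReal.ofReal (D a) :=
    (ae_restrict_iff' (measurableSet_interlacingBox b)).2 hg
  rw [← hI, ofReal_integral_eq_lintegral_ofReal hD (hg'.mono fun a h => h.1)]
  exact ⟨integral_nonneg_of_ae (hg'.mono fun a h => h.1),
    lintegral_congr_ae (hg'.mono fun a h => h.2)⟩

theorem ae_forall_ne {k : ℕ} (y : Fin k → ℝ) :
    ∀ᵐ z : Fin k → ℝ, ∀ i j, z i ≠ y j := by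
  refine ae_all_iff.2 fun i => ae_all_iff.2 fun j => ?_
  have := Measure.ae_eval_ne (μ := fun _ : Fin k => (volume : Measure ℝ)) i (y j)
  simpa [volume_pi] using this

/-- The chains of interlacing vectors of constant length have as volume a determinant of
truncated powers. -/
theorem volume_chainSet {k : ℕ} (m : ℕ) {x y : Fin (k + 1) → ℝ} (hx : Monotone x)
    (hy : Monotone y) (hxy : m = 0 → ∀ i j, x i ≠ y j) :
    0 ≤ (Matrix.of fun i j => truncPow (m + 1) (x j - y i)).det ∧
      volume (chainSet m x y) =
        ENNReal.ofReal (Matrix.of fun i j => truncPow (m + 1) (x j - y i)).det := by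
  induction m generalizing x with
  | zero =>
    rw [zero_add, det_truncPow_one hx hy (hxy rfl)]
    have : chainSet 0 x y = {_z | ShiftInterlaces x y} := by
      ext z
      simp [chainSet, Fin.snoc]
    rw [this]
    split_ifs with h
    · simp [h, volume_pi]
    · simp [h]
  | succ m ih =>
    -- The first coordinate of a vector interlacing with `x` is not bounded below. Only the part
    -- above `c` contributes, and it consists of the vectors interlacing with `(c, x)`.
    set c := min (x 0) (y 0)
    let b : Fin (k + 2) → ℝ := Fin.cons c x
    have hb : Monotone b := by
      refine Fin.monotone_iff_le_succ.2 fun i => Fin.cases ?_ (fun i => ?_) i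
      · simp [b, c]
      · simpa [b, ← Fin.succ_castSucc] using hx Fin.castSucc_lt_succ.le
    have hbox : ∀ z, z ∈ interlacingBox b ↔ ShiftInterlaces x z ∧ c ≤ z 0 := by
      intro z
      simp only [mem_interlacingBox, Interlaces, forall_and, b, Fin.cons_succ, ShiftInterlaces]
      rw [Fin.forall_fin_succ]
      simp only [Fin.castSucc_zero, Fin.cons_zero, ← Fin.succ_castSucc, Fin.cons_succ]
      constructor
      · rintro ⟨⟨h1, h2⟩, h3⟩
        refine ⟨⟨h3, fun a b hab => ?_⟩, h1⟩
        obtain ⟨b, rfl⟩ := Fin.exists_succ_eq.2 (show b ≠ 0 by rintro rfl; simp at hab)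
        have : a = b.castSucc := by ext; simpa using hab.symm
        rw [this]
        exact h2 b
      · rintro ⟨⟨h1, h2⟩, h3⟩
        exact ⟨⟨h3, fun i => h2 _ _ (by simp)⟩, h1⟩
    have hint : ∀ (i : Fin (k + 1)) u v,
        IntervalIntegrable (fun t => truncPow (m + 1) (t - y i)) volume u v := fun i u v =>
      Monotone.intervalIntegrable fun s t hst => monotone_truncPow _ (by linarith)
    have hI := integral_interlacingBox_det_eq hb 1 0
      (fun i t => truncPow (m + 1) (t - y i))
      (Fin.cons (fun _ => 1) fun i t => truncPow (m + 2) (t - y i)) hint (fun _ => rfl) (by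
        intro i u v
        have := integral_truncPow_affine m 1 (-y i) u v
        simpa [sub_eq_add_neg] using this)
    have hlast : (Matrix.of fun i j => (Fin.cons (fun _ => 1) fun i t => truncPow (m + 2) (t - y i) :
        Fin (k + 2) → ℝ → ℝ) i (b j)).det =
        (Matrix.of fun i j => truncPow (m + 1 + 1) (x j - y i)).det := by
      -- By the choice of `c` the first column is `(1, 0, …, 0)`.
      rw [Matrix.det_succ_column_zero, Fin.sum_univ_succ, Finset.sum_eq_zero, add_zero]
      · simp [b, Matrix.submatrix]
      · intro i _
        have : c ≤ y i := (min_le_right _ _).trans (hy (Fin.zero_le i))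
        simp [b, truncPow_of_nonpos, this]
    rw [hlast] at hI
    simp only [one_pow, one_mul, Fin.val_zero, pow_zero] at hI
    have hmain := lintegral_interlacingBox_ofReal (integral_interlacingBox_det hb _ hint).1 hI
      (g := fun z => volume (chainSet m z y)) (by
        filter_upwards [ae_forall_ne y] with z hz hzb
        exact ih (monotone_of_mem_interlacingBox hzb) fun _ => hz)
    refine ⟨hmain.1, ?_⟩
    rw [volume_chainSet_succ, ← hmain.2, ← lintegral_indicator (measurableSet_shiftInterlaces x),
      ← lintegral_indicator (measurableSet_interlacingBox b)]
    refine lintegral_congr_ae ?_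
    filter_upwards [ae_forall_ne y] with z hz
    have hzb := hbox z
    simp only [Set.indicator, Set.mem_ofPred_eq]
    by_cases h : ShiftInterlaces x z
    · by_cases h' : c ≤ z 0
      · simp [h, h', hzb]
      · -- Below `c` the determinant has a vanishing column.
        have hzm : Monotone z := by
          refine Fin.monotone_iff_le_succ.2 fun i => ?_
          exact (h.1 _).trans (h.2 _ _ (by simp))
        have hc : z 0 < c := not_le.1 h'
        rw [if_pos h, if_neg (by tauto), (ih hzm fun _ => hz).2,
          Matrix.det_eq_zero_of_column_eq_zero 0, ENNReal.ofReal_zero]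
        intro i
        have : c ≤ y i := (min_le_right _ _).trans (hy (Fin.zero_le i))
        exact truncPow_of_nonpos _ (by linarith)
    · simp [h, hzb]

/-! ### Reduction of the double cone for `n = ρ` to chains of constant length -/

/-- Interpretation of a triangular array as a function on `ℕ × ℕ`, by zero outside the array. -/
def levelExt {N : ℕ} (w : (j : Fin N) → Fin j → ℝ) (j b : ℕ) : ℝ :=
  if h : ∃ _ : j < N, b < j then w ⟨j, h.1⟩ ⟨b, h.2⟩ else 0

theorem levelExt_apply {N : ℕ} (w : (j : Fin N) → Fin j → ℝ) {j b : ℕ} (hj : j < N) (hb : b < j) :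
    levelExt w j b = w ⟨j, hj⟩ ⟨b, hb⟩ :=
  dif_pos ⟨hj, hb⟩

theorem levelExt_tower_of_lt {n : ℕ} (x : Fin n → ℝ) (u : Levels n) {j b : ℕ} (hj : j < n) :
    levelExt (tower x u) j b = levelExt u j b := by
  have h : tower x u (Fin.castSucc ⟨j, hj⟩) = u ⟨j, hj⟩ :=
    Fin.snoc_castSucc (α := fun k : Fin (n + 1) => Fin k → ℝ) _ _ _
  by_cases hb : b < j
  · rw [levelExt_apply _ (Nat.lt_succ_of_lt hj) hb, levelExt_apply _ hj hb]
    exact congrFun h _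
  · rw [levelExt, levelExt, dif_neg (by tauto), dif_neg (by tauto)]

theorem levelExt_tower_self {n : ℕ} (x : Fin n → ℝ) (u : Levels n) {b : ℕ} (hb : b < n) :
    levelExt (tower x u) n b = x ⟨b, hb⟩ := by
  have h : tower x u (Fin.last n) = x := by simp [tower]
  rw [levelExt_apply _ (Nat.lt_succ_self n) hb]
  exact congrFun h _

theorem mem_singleCone_iff {n : ℕ} {x : Fin n → ℝ} {u : Levels n} :
    u ∈ singleCone x ↔ ∀ m < n, ∀ a < m,
      levelExt (tower x u) (m + 1) a ≤ levelExt (tower x u) m a ∧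
        levelExt (tower x u) m a ≤ levelExt (tower x u) (m + 1) (a + 1) := by
  have key : ∀ (m : ℕ) (hm : m < n) (a : ℕ) (ha : a < m),
      (tower x u (Fin.succ ⟨m, hm⟩) (Fin.castSucc ⟨a, ha⟩) ≤ tower x u (Fin.castSucc ⟨m, hm⟩) ⟨a, ha⟩ ∧
        tower x u (Fin.castSucc ⟨m, hm⟩) ⟨a, ha⟩ ≤ tower x u (Fin.succ ⟨m, hm⟩) (Fin.succ ⟨a, ha⟩)) ↔
      (levelExt (tower x u) (m + 1) a ≤ levelExt (tower x u) m a ∧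
        levelExt (tower x u) m a ≤ levelExt (tower x u) (m + 1) (a + 1)) := by
    intro m hm a ha
    rw [levelExt_apply _ (by omega) (by omega), levelExt_apply _ (by omega) ha,
      levelExt_apply _ (by omega) (by omega)]
    rfl
  constructor
  · exact fun h m hm a ha => (key m hm a ha).1 (h ⟨m, hm⟩ ⟨a, ha⟩)
  · exact fun h m a => (key m m.2 a a.2).2 (h m m.2 a a.2)

theorem mem_cone_iff {n ρ : ℕ} {x y : Fin n → ℝ} {p : Levels n × Levels n} :
    p ∈ cone ρ x y ↔ p.1 ∈ singleCone x ∧ p.2 ∈ singleCone y ∧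
      ∀ i ≤ n, ∀ j ≤ n, i + j = ρ + 1 → ∀ a < i, ∀ b < j,
        levelExt (tower y p.2) i a ≤ levelExt (tower x p.1) j b := by
  refine and_congr_right fun _ => and_congr_right fun _ => ?_
  constructor
  · intro h i hi j hj hij a ha b hb
    rw [levelExt_apply _ (by omega) ha, levelExt_apply _ (by omega) hb]
    exact h ⟨i, by omega⟩ ⟨j, by omega⟩ hij ⟨a, ha⟩ ⟨b, hb⟩
  · intro h i j hij a b
    have := h i (by omega) j (by omega) hij a a.2 b b.2
    rwa [levelExt_apply _ i.2 a.2, levelExt_apply _ j.2 b.2] at this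

theorem levelExt_monotone_of_mem_singleCone {n : ℕ} {x : Fin n → ℝ} (hx : Monotone x)
    {u : Levels n} (hu : u ∈ singleCone x) {m : ℕ} (hm : m ≤ n) {a b : ℕ} (hab : a ≤ b)
    (hb : b < m) : levelExt (tower x u) m a ≤ levelExt (tower x u) m b := by
  rcases hm.lt_or_eq with h | rfl
  · induction b, hab using Nat.le_induction with
    | base => exact le_rfl
    | succ b hab ih =>
      have := mem_singleCone_iff.1 hu m h
      exact (ih (by omega)).trans ((this b (by omega)).2.trans (this (b + 1) hb).1)
  · rw [levelExt_tower_self _ _ (hab.trans_lt hb), levelExt_tower_self _ _ hb]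
    exact hx hab

/-- The chain of vectors of constant length attached to a point of the double cone: its `i`-th
vector consists of the `i`-th vector of the cone over `y` followed by the vector of complementary
length in the cone over `x`. -/
def coneToChain {k : ℕ} (p : Levels (k + 1) × Levels (k + 1)) : (Σ _ : Fin k, Fin (k + 1)) → ℝ :=
  fun s => if (s.2 : ℕ) < s.1 + 1 then levelExt p.2 (s.1 + 1) s.2
    else levelExt p.1 (k + 1 - (s.1 + 1)) (s.2 - (s.1 + 1))

theorem coneToChain_mem_chainSet {k : ℕ} {x y : Fin (k + 1) → ℝ} (hx : Monotone x)
    (hy : Monotone y) (p : Levels (k + 1) × Levels (k + 1)) :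
    Sigma.curry (γ := fun (_ : Fin k) (_ : Fin (k + 1)) => ℝ) (coneToChain p) ∈ chainSet k x y ↔
      p ∈ cone (k + 1) x y := by
  set X := levelExt (tower x p.1) with hX
  set Y := levelExt (tower y p.2) with hY
  -- The whole chain, with `Z 0 = x` and `Z (k + 1) = y`.
  let Z : ℕ → ℕ → ℝ := fun i b => if b < i then Y i b else X (k + 1 - i) (b - i)
  set z := Sigma.curry (γ := fun (_ : Fin k) (_ : Fin (k + 1)) => ℝ) (coneToChain p) with hz
  have hzZ : ∀ (i : Fin k) (b : Fin (k + 1)), z i b = Z (i + 1) b := by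
    intro i b
    simp only [hz, Sigma.curry, coneToChain, Z, hX, hY]
    rw [levelExt_tower_of_lt _ _ (by omega), levelExt_tower_of_lt _ _ (by omega)]
  have hcons : ∀ (i b : Fin (k + 1)), (Fin.cons (α := fun _ => Fin (k + 1) → ℝ) x z i) b = Z i b := by
    intro i b
    refine Fin.cases ?_ (fun i => ?_) i
    · simp only [Fin.cons_zero, Z, Fin.val_zero, Nat.not_lt_zero, if_false, Nat.sub_zero, hX]
      rw [levelExt_tower_self _ _ b.2]
    · simpa using hzZ i b
  have hsnoc : ∀ (i b : Fin (k + 1)), (Fin.snoc (α := fun _ => Fin (k + 1) → ℝ) z y i) b =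
      Z (i + 1) b := by
    intro i b
    refine Fin.lastCases ?_ (fun i => ?_) i
    · simp only [Fin.snoc_last, Z, Fin.val_last, b.2, if_true, hY]
      rw [levelExt_tower_self _ _ b.2]
    · simpa using hzZ i b
  have hchain : z ∈ chainSet k x y ↔ ∀ i ≤ k, (∀ b ≤ k, Z (i + 1) b ≤ Z i b) ∧
      ∀ b < k, Z i b ≤ Z (i + 1) (b + 1) := by
    simp only [chainSet, Set.mem_ofPred_eq, ShiftInterlaces, hcons, hsnoc]
    constructor
    · exact fun h i hi => ⟨fun b hb => (h ⟨i, by omega⟩).1 ⟨b, by omega⟩,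
        fun b hb => (h ⟨i, by omega⟩).2 ⟨b, by omega⟩ ⟨b + 1, by omega⟩ rfl⟩
    · exact fun h i => ⟨fun b => (h i (by omega)).1 b (by omega),
        fun a b hab => by rw [hab]; exact (h i (by omega)).2 a (by omega)⟩
  rw [hchain, mem_cone_iff]
  constructor
  · intro h
    have hu : p.1 ∈ singleCone x := by
      refine mem_singleCone_iff.2 fun m hm a ha => ⟨?_, ?_⟩
      · have := (h (k - m) (by omega)).2 (k - m + a) (by omega)
        simp only [Z] at this
        rw [if_neg (by omega), if_neg (by omega)] at this
        convert this using 2 <;> omega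
      · have := (h (k - m) (by omega)).1 (k - m + 1 + a) (by omega)
        simp only [Z] at this
        rw [if_neg (by omega), if_neg (by omega)] at this
        convert this using 2 <;> omega
    have hv : p.2 ∈ singleCone y := by
      refine mem_singleCone_iff.2 fun m hm a ha => ⟨?_, ?_⟩
      · have := (h m (by omega)).1 a (by omega)
        simp only [Z] at this
        rwa [if_pos (by omega), if_pos (by omega)] at this
      · have := (h m (by omega)).2 a (by omega)
        simp only [Z] at this
        rwa [if_pos (by omega), if_pos (by omega)] at this
    refine ⟨hu, hv, fun i hi j hj hij a ha b hb => ?_⟩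
    have h1 : Y i (i - 1) ≤ X j 0 := by
      have := (h (i - 1) (by omega)).1 (i - 1) (by omega)
      simp only [Z] at this
      rw [if_pos (by omega), if_neg (by omega)] at this
      convert this using 2 <;> omega
    exact (levelExt_monotone_of_mem_singleCone hy hv hi (show a ≤ i - 1 by omega) (by omega)).trans
      (h1.trans (levelExt_monotone_of_mem_singleCone hx hu hj (Nat.zero_le b) hb))
  · rintro ⟨hu, hv, h⟩ i hi
    have hu := mem_singleCone_iff.1 hu
    have hv := mem_singleCone_iff.1 hv
    refine ⟨fun b hb => ?_, fun b hb => ?_⟩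
    · simp only [Z]
      rcases lt_trichotomy b i with hbi | rfl | hbi
      · rw [if_pos (by omega), if_pos hbi]
        exact (hv i (by omega) b hbi).1
      · rw [if_pos (by omega), if_neg (by omega), Nat.sub_self]
        exact h _ (by omega) _ (by omega) (by omega) _ (by omega) _ (by omega)
      · rw [if_neg (by omega), if_neg (by omega)]
        have := (hu (k - i) (by omega) (b - i - 1) (by omega)).2
        convert this using 2 <;> omega
    · simp only [Z]
      by_cases hbi : b < i
      · rw [if_pos hbi, if_pos (by omega)]
        exact (hv i (by omega) b hbi).2
      · rw [if_neg hbi, if_neg (by omega)]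
        have := (hu (k - i) (by omega) (b - i) (by omega)).1
        convert this using 2 <;> omega

theorem measurePreserving_uncurry {ι : Type*} [Fintype ι] {κ : ι → Type*} [∀ i, Fintype (κ i)] :
    MeasurePreserving (Sigma.uncurry : ((i : ι) → κ i → ℝ) → ((s : Σ i, κ i) → ℝ)) := by
  have hm : Measurable (Sigma.uncurry : ((i : ι) → κ i → ℝ) → ((s : Σ i, κ i) → ℝ)) := by
    refine measurable_pi_lambda _ fun s => ?_
    exact (measurable_pi_apply s.2).comp (measurable_pi_apply s.1)
  refine ⟨hm, ?_⟩
  rw [volume_pi]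
  refine (Measure.pi_eq fun s hs => ?_).symm
  rw [Measure.map_apply hm (MeasurableSet.univ_pi hs)]
  have : (Sigma.uncurry : ((i : ι) → κ i → ℝ) → ((s : Σ i, κ i) → ℝ)) ⁻¹' (Set.univ.pi s) =
      Set.univ.pi fun i => Set.univ.pi fun b => s ⟨i, b⟩ := by
    ext w
    simp only [Set.mem_preimage, Set.mem_univ_pi, Sigma.forall]
    rfl
  rw [this, Measure.pi_pi, Fintype.prod_sigma]
  exact Finset.prod_congr rfl fun i _ => volume_pi_pi _

theorem measurePreserving_sumElim_comp {α β γ : Type*} [Fintype α] [Fintype β] [Fintype γ]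
    (e : γ ≃ α ⊕ β) :
    MeasurePreserving (fun (p : (α → ℝ) × (β → ℝ)) (c : γ) => Sum.elim p.1 p.2 (e c)) := by
  have hm : Measurable (fun (p : (α → ℝ) × (β → ℝ)) (c : γ) => Sum.elim p.1 p.2 (e c)) := by
    refine measurable_pi_lambda _ fun c => ?_
    rcases e c with a | b
    · exact (measurable_pi_apply a).comp measurable_fst
    · exact (measurable_pi_apply b).comp measurable_snd
  refine ⟨hm, ?_⟩
  rw [volume_pi]
  refine (Measure.pi_eq fun s hs => ?_).symm
  rw [Measure.map_apply hm (MeasurableSet.univ_pi hs)]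
  have : (fun (p : (α → ℝ) × (β → ℝ)) (c : γ) => Sum.elim p.1 p.2 (e c)) ⁻¹' (Set.univ.pi s) =
      (Set.univ.pi fun a => s (e.symm (Sum.inl a))) ×ˢ
        (Set.univ.pi fun b => s (e.symm (Sum.inr b))) := by
    ext w
    simp only [Set.mem_preimage, Set.mem_univ_pi, Set.mem_prod]
    rw [e.symm.surjective.forall, Sum.forall]
    simp
  rw [this, Measure.volume_eq_prod, Measure.prod_prod, volume_pi_pi, volume_pi_pi,
    ← e.symm.prod_comp, Fintype.prod_sum_type]

/-- The reindexing of coordinates underlying `coneToChain`. -/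
def chainIndex (k : ℕ) :
    (Σ _ : Fin k, Fin (k + 1)) ≃ (Σ j : Fin (k + 1), Fin j) ⊕ (Σ j : Fin (k + 1), Fin j) where
  toFun s := if h : (s.2 : ℕ) < s.1 + 1 then Sum.inr ⟨⟨s.1 + 1, by omega⟩, ⟨s.2, h⟩⟩
    else Sum.inl ⟨⟨k + 1 - (s.1 + 1), by omega⟩, ⟨s.2 - (s.1 + 1), by dsimp only; omega⟩⟩
  invFun := Sum.elim
    (fun s => ⟨⟨k - s.1, by have := s.2.2; omega⟩, ⟨k - s.1 + 1 + s.2, by omega⟩⟩)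
    (fun s => ⟨⟨s.1 - 1, by have := s.2.2; omega⟩, ⟨s.2, by omega⟩⟩)
  left_inv s := by
    obtain ⟨i, b⟩ := s
    dsimp only
    split_ifs with h
    · simp
    · simp only [Sum.elim_inl, Sigma.mk.injEq, heq_eq_eq, Fin.ext_iff]
      omega
  right_inv s := by
    rcases s with ⟨j, b⟩ | ⟨j, b⟩
    · have hb := b.2
      have hj : k + 1 - (k - (j : ℕ) + 1) = j := by omega
      dsimp only [Sum.elim_inl]
      rw [dif_neg (by omega)]
      congr 1
      refine Sigma.ext (Fin.ext hj) ?_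
      refine (Fin.heq_ext_iff hj).2 ?_
      dsimp only
      omega
    · have hb := b.2
      have hj : (j : ℕ) - 1 + 1 = j := by omega
      dsimp only [Sum.elim_inr]
      rw [dif_pos (by omega)]
      congr 1
      refine Sigma.ext (Fin.ext hj) ?_
      exact (Fin.heq_ext_iff hj).2 rfl

theorem measurePreserving_coneToChain (k : ℕ) :
    MeasurePreserving (coneToChain : Levels (k + 1) × Levels (k + 1) → _) := by
  have h := (measurePreserving_sumElim_comp (chainIndex k)).comp
    ((measurePreserving_uncurry (κ := fun j : Fin (k + 1) => Fin j)).prod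
      (measurePreserving_uncurry (κ := fun j : Fin (k + 1) => Fin j)))
  rw [Measure.volume_eq_prod]
  convert h using 1
  ext p s
  simp only [coneToChain, chainIndex, Function.comp, Equiv.coe_fn_mk, Prod.map]
  split_ifs with hs
  · rw [levelExt_apply _ (by omega) hs]
    rfl
  · rw [levelExt_apply _ (by omega) (by omega)]
    rfl

theorem volume_cone_eq_volume_chainSet {k : ℕ} {x y : Fin (k + 1) → ℝ} (hx : Monotone x)
    (hy : Monotone y) : volume (cone (k + 1) x y) = volume (chainSet k x y) := by
  set S : Set ((Σ _ : Fin k, Fin (k + 1)) → ℝ) :=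
    Sigma.curry (γ := fun (_ : Fin k) (_ : Fin (k + 1)) => ℝ) ⁻¹' chainSet k x y
  have hS : MeasurableSet S := by
    refine MeasurableSet.preimage (measurableSet_chainSet x y) ?_
    exact measurable_pi_lambda _ fun i => measurable_pi_lambda _ fun b => measurable_pi_apply _
  have h1 : coneToChain ⁻¹' S = cone (k + 1) x y :=
    Set.ext fun p => coneToChain_mem_chainSet hx hy p
  have h2 : Sigma.uncurry ⁻¹' S = chainSet k x y := rfl
  rw [← h1, ← h2, (measurePreserving_coneToChain k).measure_preimage hS.nullMeasurableSet,
    measurePreserving_uncurry.measure_preimage hS.nullMeasurableSet]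

/-! ### Peeling off the top levels -/

theorem continuous_levelExt {N : ℕ} (j b : ℕ) :
    Continuous fun w : (j : Fin N) → Fin j → ℝ => levelExt w j b := by
  unfold levelExt
  split_ifs with h
  · exact (continuous_apply _).comp (continuous_apply _)
  · exact continuous_const

theorem continuous_levelExt_tower {n : ℕ} (x : Fin n → ℝ) (j b : ℕ) :
    Continuous fun u : Levels n => levelExt (tower x u) j b := by
  by_cases hj : j < n
  · simp only [levelExt_tower_of_lt _ _ hj]
    exact continuous_levelExt j b
  · by_cases h : j = n ∧ b < n
    · obtain ⟨rfl, hb⟩ := h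
      simp only [levelExt_tower_self _ _ hb]
      exact continuous_const
    · have : ∀ u : Levels n, levelExt (tower x u) j b = 0 := fun u =>
        dif_neg (by rintro ⟨h1, h2⟩; omega)
      simp only [this]
      exact continuous_const

theorem isClosed_singleCone {n : ℕ} (x : Fin n → ℝ) : IsClosed (singleCone x) := by
  have : singleCone x = {u | ∀ m < n, ∀ a < m,
      levelExt (tower x u) (m + 1) a ≤ levelExt (tower x u) m a ∧
        levelExt (tower x u) m a ≤ levelExt (tower x u) (m + 1) (a + 1)} :=
    Set.ext fun u => mem_singleCone_iff
  rw [this]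
  simp only [Set.ofPred_forall, Set.ofPred_and]
  exact isClosed_iInter fun m => isClosed_iInter fun _ => isClosed_iInter fun a =>
    isClosed_iInter fun _ => IsClosed.inter
      (isClosed_le (continuous_levelExt_tower x _ _) (continuous_levelExt_tower x _ _))
      (isClosed_le (continuous_levelExt_tower x _ _) (continuous_levelExt_tower x _ _))

theorem measurableSet_cone {n : ℕ} (ρ : ℕ) (x y : Fin n → ℝ) : MeasurableSet (cone ρ x y) := by
  refine IsClosed.measurableSet ?_
  have : cone ρ x y = (Prod.fst ⁻¹' singleCone x ∩ Prod.snd ⁻¹' singleCone y) ∩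
      {p | ∀ i ≤ n, ∀ j ≤ n, i + j = ρ + 1 → ∀ a < i, ∀ b < j,
        levelExt (tower y p.2) i a ≤ levelExt (tower x p.1) j b} := by
    ext p
    rw [mem_cone_iff, Set.mem_inter_iff, Set.mem_inter_iff, and_assoc]
    rfl
  rw [this]
  refine IsClosed.inter (((isClosed_singleCone x).preimage continuous_fst).inter
    ((isClosed_singleCone y).preimage continuous_snd)) ?_
  simp only [Set.ofPred_forall]
  exact isClosed_iInter fun i => isClosed_iInter fun _ => isClosed_iInter fun j =>
    isClosed_iInter fun _ => isClosed_iInter fun _ => isClosed_iInter fun a =>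
    isClosed_iInter fun _ => isClosed_iInter fun b => isClosed_iInter fun _ =>
    isClosed_le ((continuous_levelExt_tower y _ _).comp continuous_snd)
      ((continuous_levelExt_tower x _ _).comp continuous_fst)

theorem tower_mem_singleCone_iff {n : ℕ} (x : Fin (n + 1) → ℝ) (u : Levels n) (x' : Fin n → ℝ) :
    (tower x' u : Levels (n + 1)) ∈ singleCone x ↔ Interlaces x x' ∧ u ∈ singleCone x' := by
  have h1 : tower x (tower x' u) (Fin.last (n + 1)) = x :=
    Fin.snoc_last (α := fun k : Fin (n + 1 + 1) => Fin k → ℝ) _ _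
  have h2 : ∀ j : Fin (n + 1), tower x (tower x' u) j.castSucc = tower x' u j := fun j =>
    Fin.snoc_castSucc (α := fun k : Fin (n + 1 + 1) => Fin k → ℝ) _ _ _
  have h3 : tower x' u (Fin.last n) = x' :=
    Fin.snoc_last (α := fun k : Fin (n + 1) => Fin k → ℝ) _ _
  constructor
  · intro h
    refine ⟨?_, fun k => ?_⟩
    · have := h (Fin.last n)
      rw [h2] at this
      change Interlaces (tower x (tower x' u) (Fin.last (n + 1))) _ at this
      rwa [h1, h3] at this
    · have := h k.castSucc
      rw [h2] at this
      change Interlaces (tower x (tower x' u) (Fin.castSucc k.succ)) _ at this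
      rwa [h2] at this
  · rintro ⟨h, hu⟩ k
    refine Fin.lastCases ?_ (fun k => ?_) k
    · rw [h2]
      change Interlaces (tower x (tower x' u) (Fin.last (n + 1))) _
      rwa [h1, h3]
    · rw [h2]
      change Interlaces (tower x (tower x' u) (Fin.castSucc k.succ)) _
      rw [h2]
      exact hu k

theorem tower_mem_cone_iff {n ρ : ℕ} (hn : ρ ≤ n) (x y : Fin (n + 1) → ℝ)
    (u v : Levels n) (x' y' : Fin n → ℝ) :
    ((tower x' u, tower y' v) : Levels (n + 1) × Levels (n + 1)) ∈ cone ρ x y ↔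
      (Interlaces x x' ∧ Interlaces y y') ∧ (u, v) ∈ cone ρ x' y' := by
  have hlt : ∀ (x : Fin (n + 1) → ℝ) (x' : Fin n → ℝ) (u : Levels n) (j b : ℕ), j ≤ n →
      levelExt (tower x (tower x' u)) j b = levelExt (tower x' u) j b := fun x x' u j b hj =>
    levelExt_tower_of_lt _ _ (by omega)
  simp only [mem_cone_iff, tower_mem_singleCone_iff]
  constructor
  · rintro ⟨⟨h1, h2⟩, ⟨h3, h4⟩, h⟩
    refine ⟨⟨h1, h3⟩, h2, h4, fun i hi j hj hij a ha b hb => ?_⟩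
    have := h i (by omega) j (by omega) hij a ha b hb
    rwa [hlt _ _ _ _ _ hi, hlt _ _ _ _ _ hj] at this
  · rintro ⟨⟨h1, h3⟩, h2, h4, h⟩
    refine ⟨⟨h1, h2⟩, ⟨h3, h4⟩, fun i hi j hj hij a ha b hb => ?_⟩
    have hi' : i ≤ n := by omega
    have hj' : j ≤ n := by omega
    rw [hlt _ _ _ _ _ hi', hlt _ _ _ _ _ hj']
    exact h i hi' j hj' hij a ha b hb

theorem measurePreserving_tower (n : ℕ) :
    MeasurePreserving (fun p : Levels n × (Fin n → ℝ) => (tower p.2 p.1 : Levels (n + 1))) := by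
  have h1 : ∀ (p : Levels n × (Fin n → ℝ)) (j : Fin n), tower p.2 p.1 j.castSucc = p.1 j :=
    fun p j => Fin.snoc_castSucc (α := fun k : Fin (n + 1) => Fin k → ℝ) _ _ _
  have h2 : ∀ (p : Levels n × (Fin n → ℝ)), tower p.2 p.1 (Fin.last n) = p.2 := fun p =>
    Fin.snoc_last (α := fun k : Fin (n + 1) => Fin k → ℝ) _ _
  have hm : Measurable (fun p : Levels n × (Fin n → ℝ) => (tower p.2 p.1 : Levels (n + 1))) := by
    refine measurable_pi_lambda _ fun j => Fin.lastCases ?_ (fun j => ?_) j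
    · simp only [h2]
      exact measurable_snd
    · simp only [h1]
      exact (measurable_pi_apply j).comp measurable_fst
  refine ⟨hm, ?_⟩
  rw [volume_pi (α := fun j : Fin (n + 1) => Fin j → ℝ)]
  refine (Measure.pi_eq fun s hs => ?_).symm
  rw [Measure.map_apply hm (MeasurableSet.univ_pi hs)]
  have : (fun p : Levels n × (Fin n → ℝ) => (tower p.2 p.1 : Levels (n + 1))) ⁻¹' (Set.univ.pi s) =
      (Set.univ.pi fun j : Fin n => s j.castSucc) ×ˢ (s (Fin.last n)) := by
    ext p
    simp only [Set.mem_preimage, Set.mem_univ_pi, Set.mem_prod, Fin.forall_fin_succ', h1, h2]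
  rw [this, Measure.volume_eq_prod, Measure.prod_prod, Fin.prod_univ_castSucc]
  congr 1
  exact volume_pi_pi _

theorem prod_apply_shuffle {A B U V : Type*} [MeasureSpace A] [MeasureSpace B] [MeasureSpace U]
    [MeasureSpace V] [SFinite (volume : Measure A)] [SFinite (volume : Measure B)]
    [SFinite (volume : Measure U)] [SFinite (volume : Measure V)]
    {S : Set ((U × A) × (V × B))} (hS : MeasurableSet S) :
    volume S = ∫⁻ a, ∫⁻ b, volume {q : U × V | ((q.1, a), (q.2, b)) ∈ S} := by
  simp only [Measure.volume_eq_prod]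
  rw [Measure.prod_apply hS, lintegral_prod_symm' _ (measurable_measure_prodMk_left hS)]
  refine lintegral_congr fun a => ?_
  have h1 : ∀ u : U, (volume.prod volume) (Prod.mk (u, a) ⁻¹' S) =
      ∫⁻ b : B, volume {v : V | ((u, a), (v, b)) ∈ S} := fun u =>
    Measure.prod_apply_symm (measurable_prodMk_left hS)
  simp only [h1]
  have hm : MeasurableSet {q : (U × B) × V | ((q.1.1, a), (q.2, q.1.2)) ∈ S} :=
    hS.preimage (by fun_prop)
  rw [lintegral_lintegral_swap (measurable_measure_prodMk_left hm).aemeasurable]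
  refine lintegral_congr fun b => ?_
  have hm' : MeasurableSet {q : U × V | ((q.1, a), (q.2, b)) ∈ S} := hS.preimage (by fun_prop)
  rw [Measure.prod_apply hm']
  rfl

/-- The levels just below the top are only subject to interlacing if the top is longer than `ρ`. -/
theorem volume_cone_succ {n ρ : ℕ} (hn : ρ ≤ n) (x y : Fin (n + 1) → ℝ) :
    volume (cone ρ x y) =
      ∫⁻ x' in interlacingBox x, ∫⁻ y' in interlacingBox y, volume (cone ρ x' y') := by
  have hmp := (measurePreserving_tower n).prod (measurePreserving_tower n)
  rw [← Measure.volume_eq_prod, ← Measure.volume_eq_prod] at hmp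
  have hS := measurableSet_cone ρ x y
  rw [← hmp.measure_preimage hS.nullMeasurableSet, prod_apply_shuffle (hmp.measurable hS),
    ← lintegral_indicator (measurableSet_interlacingBox x)]
  refine lintegral_congr fun x' => ?_
  by_cases hx : x' ∈ interlacingBox x
  · rw [Set.indicator_of_mem hx, ← lintegral_indicator (measurableSet_interlacingBox y)]
    refine lintegral_congr fun y' => ?_
    by_cases hy : y' ∈ interlacingBox y
    · rw [Set.indicator_of_mem hy]
      congr 1
      ext p
      refine (tower_mem_cone_iff hn x y p.1 p.2 x' y').trans ?_
      rw [mem_interlacingBox] at hx hy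
      simp [hx, hy]
    · rw [Set.indicator_of_notMem hy]
      convert measure_empty (μ := (volume : Measure (Levels n × Levels n)))
      ext p
      refine (tower_mem_cone_iff hn x y p.1 p.2 x' y').trans ?_
      rw [mem_interlacingBox] at hy
      simp [hy]
  · rw [Set.indicator_of_notMem hx]
    refine (lintegral_congr fun y' => ?_).trans lintegral_zero
    convert measure_empty (μ := (volume : Measure (Levels n × Levels n)))
    ext p
    refine (tower_mem_cone_iff hn x y p.1 p.2 x' y').trans ?_
    rw [mem_interlacingBox] at hx
    simp [hx]

/-- The integral of `g` over the bottom vectors of all chains `x ≻ x⁽ʳ⁺ᵃ⁻¹⁾ ≻ ⋯ ≻ x⁽ʳ⁾` of `a`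
interlacing vectors of decreasing length, with respect to Lebesgue measure on the chains. -/
def lintegralChain {r : ℕ} (g : (Fin r → ℝ) → ENNReal) :
    (a : ℕ) → (Fin (r + a) → ℝ) → ENNReal
  | 0, x => g x
  | a + 1, x => ∫⁻ x' in interlacingBox (k := r + a) x, lintegralChain g a x'

theorem measurable_lintegralChain {P : Type*} [MeasurableSpace P] {r : ℕ}
    {g : P → (Fin r → ℝ) → ENNReal} (hg : Measurable (Function.uncurry g)) (a : ℕ) :
    Measurable fun q : P × (Fin (r + a) → ℝ) => lintegralChain (g q.1) a q.2 := by
  induction a with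
  | zero => exact hg
  | succ a ih =>
    have hS : MeasurableSet {z : (P × (Fin (r + a + 1) → ℝ)) × (Fin (r + a) → ℝ) |
        z.2 ∈ interlacingBox z.1.2} := by
      simp only [mem_interlacingBox, Interlaces, Set.ofPred_forall, Set.ofPred_and]
      exact MeasurableSet.iInter fun i => MeasurableSet.inter
        (measurableSet_le (by fun_prop) (by fun_prop))
        (measurableSet_le (by fun_prop) (by fun_prop))
    have h1 : Measurable fun z : (P × (Fin (r + a + 1) → ℝ)) × (Fin (r + a) → ℝ) =>
        lintegralChain (g z.1.1) a z.2 :=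
      ih.comp ((measurable_fst.comp measurable_fst).prodMk measurable_snd)
    have h2 := (h1.indicator hS).lintegral_prod_right' (ν := volume)
    refine (congrArg Measurable (funext fun q => ?_)).mpr h2
    exact (lintegral_indicator (measurableSet_interlacingBox (k := r + a) q.2) _).symm

/-- Integration over a parameter commutes with `lintegralChain`. -/
theorem lintegral_lintegralChain {P : Type*} [MeasurableSpace P] (ν : Measure P) [SFinite ν]
    {r : ℕ} {g : P → (Fin r → ℝ) → ENNReal} (hg : Measurable (Function.uncurry g)) (a : ℕ)
    (x : Fin (r + a) → ℝ) :
    ∫⁻ p, lintegralChain (g p) a x ∂ν = lintegralChain (fun z => ∫⁻ p, g p z ∂ν) a x := by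
  induction a with
  | zero => rfl
  | succ a ih =>
    simp only [lintegralChain]
    rw [lintegral_lintegral_swap (measurable_lintegralChain hg a).aemeasurable]
    exact lintegral_congr fun x' => ih x'

/-- The volume of the double cone over vectors of length `ρ + δ` as an iterated integral over the
`δ` upper levels on both sides. -/
theorem volume_cone_eq_lintegralChain {ρ : ℕ}
    {g : (Fin ρ → ℝ) → (Fin ρ → ℝ) → ENNReal} (hg : Measurable (Function.uncurry g))
    (hbase : ∀ x y : Fin ρ → ℝ, Monotone x → Monotone y → (ρ = 1 → ∀ i j, x i ≠ y j) →
      volume (cone ρ x y) = g x y)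
    (δ : ℕ) {x y : Fin (ρ + δ) → ℝ} (hx : Monotone x) (hy : Monotone y)
    (hxy : ρ + δ = 1 → ∀ i j, x i ≠ y j) :
    volume (cone ρ x y) =
      lintegralChain (fun y₀ => lintegralChain (fun x₀ => g x₀ y₀) δ x) δ y := by
  induction δ with
  | zero => exact hbase x y hx hy hxy
  | succ δ ih =>
    have hm1 : Measurable (Function.uncurry fun (x' : Fin (ρ + δ) → ℝ) (y₀ : Fin ρ → ℝ) =>
        lintegralChain (fun x₀ => g x₀ y₀) δ x') :=
      (measurable_lintegralChain (g := fun y₀ x₀ => g x₀ y₀) (hg.comp measurable_swap) δ).comp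
        measurable_swap
    rw [volume_cone_succ (n := ρ + δ) (Nat.le_add_right _ _)]
    simp only [lintegralChain]
    have h1 : ∫⁻ x' in interlacingBox (k := ρ + δ) x, ∫⁻ y' in interlacingBox (k := ρ + δ) y,
          volume (cone ρ x' y') =
        ∫⁻ x' in interlacingBox (k := ρ + δ) x, ∫⁻ y' in interlacingBox (k := ρ + δ) y,
          lintegralChain (fun y₀ => lintegralChain (fun x₀ => g x₀ y₀) δ x') δ y' := by
      refine setLIntegral_congr_fun (measurableSet_interlacingBox _) fun x' hx' => ?_
      -- The vectors `x', y'` may have a common entry, but only for `y'` in a null set.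
      refine setLIntegral_congr_fun_ae (measurableSet_interlacingBox _) ?_
      filter_upwards [ae_forall_ne x'] with y' hne hy'
      exact ih (monotone_of_mem_interlacingBox hx') (monotone_of_mem_interlacingBox hy')
        fun _ i j => (hne j i).symm
    rw [h1, lintegral_lintegral_swap (measurable_lintegralChain hm1 δ).aemeasurable]
    refine lintegral_congr fun y' => ?_
    exact lintegral_lintegralChain _ hm1 δ y'

/-- Evaluation of `lintegralChain` by a sequence of functions `D a`, each of which is obtained from
the preceding one by integration over interlacing vectors. -/
theorem lintegralChain_eq_ofReal {r : ℕ} {g : (Fin r → ℝ) → ENNReal}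
    (D : (a : ℕ) → (Fin (r + a) → ℝ) → ℝ)
    (hg : ∀ x, Monotone x → 0 ≤ D 0 x ∧ g x = ENNReal.ofReal (D 0 x))
    (hD : ∀ a (x : Fin (r + a + 1) → ℝ), Monotone x →
      IntegrableOn (D a) (interlacingBox x) ∧ ∫ x' in interlacingBox x, D a x' = D (a + 1) x)
    (a : ℕ) {x : Fin (r + a) → ℝ} (hx : Monotone x) :
    0 ≤ D a x ∧ lintegralChain g a x = ENNReal.ofReal (D a x) := by
  induction a with
  | zero => exact hg x hx
  | succ a ih =>
    exact lintegral_interlacingBox_ofReal (hD a x hx).1 (hD a x hx).2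
      (Filter.Eventually.of_forall fun x' hx' => ih (monotone_of_mem_interlacingBox hx'))

/-! ### Appell pairs and reduction of determinants -/

theorem levelExt_mem_Icc {n : ℕ} {x : Fin (n + 1) → ℝ} (hx : Monotone x) {u : Levels (n + 1)}
    (hu : u ∈ singleCone x) {m : ℕ} (hm : m ≤ n + 1) :
    ∀ a < m, levelExt (tower x u) m a ∈ Set.Icc (x 0) (x (Fin.last n)) := by
  induction hm using Nat.decreasingInduction with
  | self =>
    intro a ha
    rw [levelExt_tower_self _ _ ha]
    exact ⟨hx (Fin.zero_le _), hx (Fin.le_last _)⟩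
  | of_succ m hm ih =>
    intro a ha
    have h := mem_singleCone_iff.1 hu m hm a ha
    exact ⟨(ih a (by omega)).1.trans h.1, h.2.trans (ih (a + 1) (by omega)).2⟩

theorem singleCone_subset_Icc {n : ℕ} {x : Fin (n + 1) → ℝ} (hx : Monotone x) :
    singleCone x ⊆ Set.Icc (fun _ _ => x 0) (fun _ _ => x (Fin.last n)) := by
  intro u hu
  have h : ∀ (j : Fin (n + 1)) (b : Fin j), u j b ∈ Set.Icc (x 0) (x (Fin.last n)) := by
    intro j b
    have := levelExt_mem_Icc hx hu j.2.le b b.2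
    rwa [levelExt_tower_of_lt _ _ j.2, levelExt_apply _ j.2 b.2] at this
  exact ⟨fun j b => (h j b).1, fun j b => (h j b).2⟩

theorem volume_cone_lt_top {n : ℕ} (ρ : ℕ) {x y : Fin (n + 1) → ℝ} (hx : Monotone x)
    (hy : Monotone y) : volume (cone ρ x y) < ⊤ := by
  refine (measure_mono (t := Set.Icc (fun _ _ => x 0) (fun _ _ => x (Fin.last n)) ×ˢ
    Set.Icc (fun _ _ => y 0) (fun _ _ => y (Fin.last n))) ?_).trans_lt
    (isCompact_Icc.prod isCompact_Icc).measure_lt_top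
  exact fun p hp => ⟨singleCone_subset_Icc hx hp.1, singleCone_subset_Icc hy hp.2.1⟩

/-- The double cone over vectors of length `ρ`, evaluated as a determinant. -/
theorem volume_cone_self {ρ : ℕ} (hρ : 1 ≤ ρ) {x y : Fin ρ → ℝ} (hx : Monotone x)
    (hy : Monotone y) (hxy : ρ = 1 → ∀ i j, x i ≠ y j) :
    0 ≤ (Matrix.of fun i j => truncPow ρ (x j - y i)).det ∧
      volume (cone ρ x y) =
        ENNReal.ofReal (Matrix.of fun i j => truncPow ρ (x j - y i)).det := by
  obtain ⟨k, rfl⟩ : ∃ k, ρ = k + 1 := ⟨ρ - 1, by omega⟩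
  rw [volume_cone_eq_volume_chainSet hx hy]
  exact volume_chainSet k hx hy fun hk => hxy (by omega)

/-- Evaluation of `lintegralChain` on determinants: at each step the functions in the rows are
replaced by primitives of their multiples by `c`, and a row of ones is added in position `r a`. The
hypothesis `hc` says that the sign due to this position is compensated by the sign of `c`. -/
theorem lintegralChain_det {ρ : ℕ} {g : (Fin ρ → ℝ) → ENNReal} (C : ℝ) {κ c : ℝ} (hκ : κ ≠ 0)
    (E : (a : ℕ) → Fin (ρ + a) → ℝ → ℝ) (r : (a : ℕ) → Fin (ρ + a + 1))
    (hc : ∀ a, c ^ (ρ + a) = (-1) ^ (r a : ℕ) * κ ^ (ρ + a))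
    (hg : ∀ z, Monotone z → 0 ≤ C * (Matrix.of fun i j => E 0 i (z j)).det ∧
      g z = ENNReal.ofReal (C * (Matrix.of fun i j => E 0 i (z j)).det))
    (hint : ∀ a i u v, IntervalIntegrable (E a i) volume u v)
    (hr : ∀ a t, E (a + 1) (r a) t = 1)
    (hE : ∀ a i u v,
      c * ∫ t in u..v, E a i t = E (a + 1) ((r a).succAbove i) v - E (a + 1) ((r a).succAbove i) u)
    (a : ℕ) {x : Fin (ρ + a) → ℝ} (hx : Monotone x) :
    0 ≤ C * (κ ^ (∑ i ∈ Finset.range a, (ρ + i)))⁻¹ * (Matrix.of fun i j => E a i (x j)).det ∧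
      lintegralChain g a x = ENNReal.ofReal
        (C * (κ ^ (∑ i ∈ Finset.range a, (ρ + i)))⁻¹ * (Matrix.of fun i j => E a i (x j)).det) := by
  refine lintegralChain_eq_ofReal (fun a x => C * (κ ^ (∑ i ∈ Finset.range a, (ρ + i)))⁻¹ *
    (Matrix.of fun i j => E a i (x j)).det) (by simpa using hg) (fun a x hx => ⟨?_, ?_⟩) a hx
  · exact (integral_interlacingBox_det hx (E a) (hint a)).1.const_mul _
  · have h := integral_interlacingBox_det_eq hx c (r a) (E a) (E (a + 1)) (hint a) (hr a) (hE a)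
    rw [hc, mul_assoc] at h
    have h' := mul_left_cancel₀ (pow_ne_zero _ (by norm_num)) h
    rw [integral_const_mul, Finset.sum_range_succ, pow_add]
    refine Eq.trans ?_ (congrArg
      (fun z => C * (κ ^ (∑ i ∈ Finset.range a, (ρ + i)) * κ ^ (ρ + a))⁻¹ * z) h')
    have := pow_ne_zero (ρ + a) hκ
    have := pow_ne_zero (∑ i ∈ Finset.range a, (ρ + i)) hκ
    field_simp

/-- A pair of sequences of polynomials, of Appell type for the operators `κ⁻¹ d/dy` and
`-κ⁻¹ d/dx`, with `∑ p_a(y) q_{m-a}(x) = (κ (y - x))^m / m!`. -/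
structure AppellPair (κ : ℝ) (p q : ℕ → ℝ → ℝ) : Prop where
  p_zero : ∀ t, p 0 t = 1
  q_zero : ∀ t, q 0 t = 1
  hasDerivAt_p : ∀ m t, HasDerivAt (p (m + 1)) (κ * p m t) t
  hasDerivAt_q : ∀ m t, HasDerivAt (q (m + 1)) (-κ * q m t) t
  sum_mul : ∀ m x y, ∑ a ∈ Finset.range (m + 1), p a y * q (m - a) x =
    (κ * (y - x)) ^ m / (m.factorial : ℝ)

theorem continuous_of_appell {c : ℝ} {p : ℕ → ℝ → ℝ} (h0 : ∀ t, p 0 t = 1)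
    (h : ∀ m t, HasDerivAt (p (m + 1)) (c * p m t) t) (m : ℕ) : Continuous (p m) := by
  cases m with
  | zero => exact (funext h0 : p 0 = fun _ => 1) ▸ continuous_const
  | succ m => exact continuous_iff_continuousAt.2 fun t => (h m t).continuousAt

theorem integral_of_appell {c : ℝ} {p : ℕ → ℝ → ℝ} (h0 : ∀ t, p 0 t = 1)
    (h : ∀ m t, HasDerivAt (p (m + 1)) (c * p m t) t) (m : ℕ) (u v : ℝ) :
    c * ∫ t in u..v, p m t = p (m + 1) v - p (m + 1) u := by
  rw [← intervalIntegral.integral_const_mul]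
  exact intervalIntegral.integral_eq_sub_of_hasDerivAt (fun t _ => h m t)
    (((continuous_of_appell h0 h m).const_mul c).intervalIntegrable _ _)

/-- The matrix `(q_{n-j}(x_i))_{1 ≤ i, j ≤ n}`. -/
def appellMatrix {n : ℕ} (q : ℕ → ℝ → ℝ) (x : Fin n → ℝ) : Matrix (Fin n) (Fin n) ℝ :=
  Matrix.of fun i j => q (n - 1 - (j : ℕ)) (x i)

/-- By the binomial theorem the matrix is a product of two Vandermonde matrices and a diagonal
matrix. -/
theorem det_pow_sub_ne_zero {n : ℕ} {κ : ℝ} (hκ : κ ≠ 0) {x : Fin (n + 1) → ℝ}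
    (hx : Function.Injective x) :
    (Matrix.of fun i j => (κ * (x j - x i)) ^ n / (n.factorial : ℝ)).det ≠ 0 := by
  have h : (Matrix.of fun i j => (κ * (x j - x i)) ^ n / (n.factorial : ℝ)) =
      Matrix.projVandermonde 1 (fun i => -x i) *
        Matrix.diagonal (fun k : Fin (n + 1) => κ ^ n * (n.choose k : ℝ) / (n.factorial : ℝ)) *
        (Matrix.vandermonde x).transpose := by
    ext i j
    rw [Matrix.mul_apply]
    simp only [Matrix.mul_diagonal, Matrix.transpose_apply, Matrix.vandermonde_apply,
      Matrix.projVandermonde_apply, Matrix.of_apply]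
    rw [mul_pow, sub_eq_add_neg, add_pow, ← Fin.sum_univ_eq_sum_range
      (fun k => x j ^ k * (-x i) ^ (n - k) * (n.choose k : ℝ)), Finset.mul_sum, Finset.sum_div]
    refine Finset.sum_congr rfl fun k _ => ?_
    rw [Fin.val_rev]
    simp only [Pi.one_apply, one_pow, one_mul, Nat.add_sub_add_right]
    ring
  rw [h, Matrix.det_mul, Matrix.det_mul, Matrix.det_transpose, Matrix.det_diagonal]
  refine mul_ne_zero (mul_ne_zero ?_ ?_) (Matrix.det_vandermonde_ne_zero_iff.2 hx)
  · rw [Matrix.det_projVandermonde]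
    refine Finset.prod_ne_zero_iff.2 fun i _ => Finset.prod_ne_zero_iff.2 fun j hj => ?_
    have : x j ≠ x i := fun h => (Finset.mem_Ioi.1 hj).ne' (hx h)
    simp only [Pi.one_apply, one_mul]
    intro h
    exact this (by linarith)
  · refine Finset.prod_ne_zero_iff.2 fun k _ => ?_
    have : (n.choose k : ℝ) ≠ 0 := Nat.cast_ne_zero.2 (Nat.choose_pos (by omega)).ne'
    have := n.factorial_ne_zero
    positivity

theorem AppellPair.sum_appellMatrix {κ : ℝ} {p q : ℕ → ℝ → ℝ} (h : AppellPair κ p q) {n : ℕ}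
    (x : Fin (n + 1) → ℝ) (i : Fin (n + 1)) (y : ℝ) :
    ∑ k : Fin (n + 1), appellMatrix q x i k * p k y =
      (κ * (y - x i)) ^ n / (n.factorial : ℝ) := by
  rw [← h.sum_mul, ← Fin.sum_univ_eq_sum_range (fun k => p k y * q (n - k) (x i))]
  exact Finset.sum_congr rfl fun k _ => mul_comm _ _

/-- The product of `appellMatrix q x` with the matrix of the values of `p` is the matrix of the
powers `(κ (y_j - x_i))^(n-1) / (n-1)!`, which is invertible for `y = x`. -/
theorem AppellPair.isUnit_det {κ : ℝ} (hκ : κ ≠ 0) {p q : ℕ → ℝ → ℝ} (h : AppellPair κ p q) {n : ℕ}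
    (hn : 1 ≤ n) {x : Fin n → ℝ} (hx : Function.Injective x) : IsUnit (appellMatrix q x).det := by
  obtain ⟨n, rfl⟩ : ∃ k, n = k + 1 := ⟨n - 1, by omega⟩
  have h1 : (Matrix.of fun i j => (κ * (x j - x i)) ^ n / (n.factorial : ℝ)) =
      appellMatrix q x * Matrix.of fun (k j : Fin (n + 1)) => p k (x j) := by
    ext i j
    rw [Matrix.mul_apply]
    exact (h.sum_appellMatrix x i (x j)).symm
  have h2 := det_pow_sub_ne_zero hκ hx
  rw [h1, Matrix.det_mul] at h2
  exact isUnit_iff_ne_zero.2 (left_ne_zero_of_mul h2)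

/-- If the last `δ` rows of a matrix are the last `δ` columns of an invertible matrix `Q`, its
determinant reduces to one with `ρ` rows, by multiplication with the inverse of `Q`. -/
theorem det_eq_det_mul_det_of_rows {ρ δ : ℕ} (Q B : Matrix (Fin (ρ + δ)) (Fin (ρ + δ)) ℝ)
    (hQ : IsUnit Q.det) (hB : ∀ i : Fin (ρ + δ), ρ ≤ (i : ℕ) → ∀ j, B i j = Q j i) :
    B.det = Q.det * (Matrix.of fun s t : Fin ρ =>
      ∑ l, Q⁻¹ (Fin.castAdd δ s) l * B (Fin.castAdd δ t) l).det := by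
  let M := B * Q⁻¹.transpose
  have hM : B = M * Q.transpose := by
    rw [Matrix.mul_assoc, ← Matrix.transpose_mul, Matrix.mul_nonsing_inv _ hQ]
    simp
  have hM' : ∀ (i s), M i s = ∑ l, Q⁻¹ s l * B i l := by
    intro i s
    simp only [M, Matrix.mul_apply, Matrix.transpose_apply]
    exact Finset.sum_congr rfl fun l _ => mul_comm _ _
  have hblock : M.submatrix finSumFinEquiv finSumFinEquiv = Matrix.fromBlocks
      (Matrix.of fun t s : Fin ρ => ∑ l, Q⁻¹ (Fin.castAdd δ s) l * B (Fin.castAdd δ t) l)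
      (Matrix.of fun (t : Fin ρ) (s : Fin δ) => M (Fin.castAdd δ t) (Fin.natAdd ρ s)) 0 1 := by
    have h1 : ∀ (i : Fin δ) (s : Fin (ρ + δ)), M (Fin.natAdd ρ i) s =
        (1 : Matrix (Fin (ρ + δ)) (Fin (ρ + δ)) ℝ) s (Fin.natAdd ρ i) := by
      intro i s
      rw [hM', ← Matrix.nonsing_inv_mul Q hQ, Matrix.mul_apply]
      exact Finset.sum_congr rfl fun l _ => by rw [hB _ (by simp)]
    ext i j
    rcases i with i | i <;> rcases j with j | j
    · simp [hM']
    · simp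
    · simp only [Matrix.submatrix_apply, finSumFinEquiv_apply_left, finSumFinEquiv_apply_right, h1,
        Matrix.fromBlocks_apply₂₁, Matrix.zero_apply]
      refine Matrix.one_apply_ne fun h => ?_
      have := congrArg Fin.val h
      simp at this
      omega
    · simp [h1, Matrix.one_apply, eq_comm]
  rw [hM, Matrix.det_mul, Matrix.det_transpose, mul_comm,
    ← Matrix.det_submatrix_equiv_self finSumFinEquiv M, hblock, Matrix.det_fromBlocks_zero₂₁,
    Matrix.det_one, mul_one, ← hM]
  congr 1
  exact (Matrix.det_transpose _).symm

/-- Adding to each row from the `δ`-th on a combination of the rows before, and multiplying it by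
a constant. -/
theorem det_eq_of_rows_add {ρ δ : ℕ} {A B : Matrix (Fin (ρ + δ)) (Fin (ρ + δ)) ℝ} (w : ℝ)
    (c : Fin (ρ + δ) → Fin (ρ + δ) → ℝ)
    (h1 : ∀ i : Fin (ρ + δ), (i : ℕ) < δ → ∀ j, A i j = B i j)
    (h2 : ∀ i : Fin (ρ + δ), δ ≤ (i : ℕ) → ∀ j,
      A i j = w * B i j + ∑ a : Fin (ρ + δ), if (a : ℕ) < δ then c i a * B a j else 0) :
    A.det = w ^ ρ * B.det := by
  let L : Matrix (Fin (ρ + δ)) (Fin (ρ + δ)) ℝ := Matrix.of fun i a =>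
    if (i : ℕ) < δ then (1 : Matrix (Fin (ρ + δ)) (Fin (ρ + δ)) ℝ) i a
    else w * (1 : Matrix (Fin (ρ + δ)) (Fin (ρ + δ)) ℝ) i a + if (a : ℕ) < δ then c i a else 0
  have hA : A = L * B := by
    ext i j
    rw [Matrix.mul_apply]
    simp only [L, Matrix.of_apply]
    rcases lt_or_ge (i : ℕ) δ with hi | hi
    · simp [h1 i hi, hi, Matrix.one_apply]
    · simp [h2 i hi, hi.not_gt, Matrix.one_apply, add_mul, Finset.sum_add_distrib, ite_mul]
  have hL : L.BlockTriangular OrderDual.toDual := by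
    intro i a hia
    have hia : i < a := hia
    have h1 : (1 : Matrix (Fin (ρ + δ)) (Fin (ρ + δ)) ℝ) i a = 0 := Matrix.one_apply_ne hia.ne
    have : (i : ℕ) < a := hia
    simp only [L, Matrix.of_apply, h1]
    split_ifs <;> first | omega | simp
  rw [hA, Matrix.det_mul, Matrix.det_of_isLowerTriangular L hL]
  congr 1
  have : ∀ i : Fin (ρ + δ), L i i = if (i : ℕ) < δ then 1 else w := by
    intro i
    simp only [L, Matrix.of_apply, Matrix.one_apply_eq, mul_one]
    split_ifs <;> simp
  simp only [this]
  rw [Fin.prod_univ_eq_prod_range (fun i => if i < δ then (1 : ℝ) else w), add_comm,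
    Finset.prod_range_add, Finset.prod_eq_one, one_mul]
  · simp
  · intro i hi
    simp [Finset.mem_range.1 hi]

/-! ### The volume in terms of an Appell pair -/

theorem integral_truncPow_affine_of_pos {m : ℕ} (hm : 1 ≤ m) (c d u v : ℝ) :
    c * ∫ t in u..v, truncPow m (c * t + d) =
      truncPow (m + 1) (c * v + d) - truncPow (m + 1) (c * u + d) := by
  obtain ⟨m, rfl⟩ : ∃ k, m = k + 1 := ⟨m - 1, by omega⟩
  exact integral_truncPow_affine m c d u v

theorem intervalIntegrable_truncPow_affine (m : ℕ) (c d u v : ℝ) :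
    IntervalIntegrable (fun t => truncPow m (c * t + d)) volume u v := by
  rcases le_total 0 c with hc | hc
  · refine Monotone.intervalIntegrable fun s t hst => monotone_truncPow _ ?_
    linarith [mul_le_mul_of_nonneg_left hst hc]
  · refine Antitone.intervalIntegrable fun s t hst => monotone_truncPow _ ?_
    linarith [mul_le_mul_of_nonpos_left hst hc]

/-- The functions in the rows of the determinant obtained after `a` integrations in the variable
`x`, for a fixed vector `y₀`. -/
def xRows (κ : ℝ) (q : ℕ → ℝ → ℝ) {ρ : ℕ} (y₀ : Fin ρ → ℝ) (a : ℕ) (i : Fin (ρ + a)) (t : ℝ) : ℝ :=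
  if h : (i : ℕ) < ρ then (-1) ^ a * truncPow (ρ + a) (κ * t + -(κ * y₀ ⟨i, h⟩))
  else q (ρ + a - 1 - i) t

/-- The functions in the rows of the determinant obtained after `a` integrations in the variable
`y`, following `δ` integrations in `x` and the reduction of the determinant by the inverse of the
matrix `appellMatrix q x`. -/
def yRows (κ : ℝ) (p q : ℕ → ℝ → ℝ) {ρ δ : ℕ} (x : Fin (ρ + δ) → ℝ) (a : ℕ) (i : Fin (ρ + a))
    (t : ℝ) : ℝ :=
  if _h : (i : ℕ) < a then p i t
  else (-1) ^ (a + δ) * ∑ l, (appellMatrix q x)⁻¹ ⟨i - a, by omega⟩ l *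
    truncPow (ρ + δ + a) (-κ * t + κ * x l)

/-- For `ρ = 1` this also covers `x = y`, where the determinant is not the volume of the cone. -/
theorem det_truncPow_nonneg {ρ : ℕ} (hρ : 1 ≤ ρ) {x y : Fin ρ → ℝ} (hx : Monotone x)
    (hy : Monotone y) : 0 ≤ (Matrix.of fun i j => truncPow ρ (x j - y i)).det := by
  rcases hρ.eq_or_lt with rfl | h
  · rw [Matrix.det_fin_one, Matrix.of_apply, truncPow]
    split_ifs <;> simp
  · exact (volume_cone_self hρ hx hy (by omega)).1

/-- Each integration in `x` adds a row of ones in the last position, and the constant `-κ` makes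
the functions `q` appear in the rows added before. -/
theorem lintegralChain_xRows {κ : ℝ} (hκ : 0 < κ) {p q : ℕ → ℝ → ℝ} (hpq : AppellPair κ p q) {ρ : ℕ}
    (hρ : 1 ≤ ρ) {y₀ : Fin ρ → ℝ} (hy : Monotone y₀) (δ : ℕ) {x : Fin (ρ + δ) → ℝ}
    (hx : Monotone x) :
    0 ≤ (κ ^ (ρ * (ρ - 1)))⁻¹ * (κ ^ (∑ i ∈ Finset.range δ, (ρ + i)))⁻¹ *
        (Matrix.of fun i j => xRows κ q y₀ δ i (x j)).det ∧
      lintegralChain (fun x₀ => ENNReal.ofReal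
          (Matrix.of fun i j => truncPow ρ (x₀ j - y₀ i)).det) δ x =
        ENNReal.ofReal ((κ ^ (ρ * (ρ - 1)))⁻¹ * (κ ^ (∑ i ∈ Finset.range δ, (ρ + i)))⁻¹ *
          (Matrix.of fun i j => xRows κ q y₀ δ i (x j)).det) := by
  refine lintegralChain_det _ hκ.ne' (xRows κ q y₀) (fun a => Fin.last _) (c := -κ)
    (fun a => neg_pow _ _) ?_ ?_ ?_ ?_ δ hx
  · intro z hz
    have h1 : (Matrix.of fun i j => xRows κ q y₀ 0 i (z j)) =
        κ ^ (ρ - 1) • (Matrix.of fun i j : Fin ρ => truncPow ρ (z j - y₀ i)) := by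
      ext i j
      have hi : (i : ℕ) < ρ := i.2
      simp only [xRows, Matrix.of_apply, dif_pos hi, pow_zero, one_mul, add_zero,
        Matrix.smul_apply, smul_eq_mul]
      rw [← truncPow_mul _ hκ, ← sub_eq_add_neg, ← mul_sub]
      rfl
    have h2 : (κ ^ (ρ * (ρ - 1)))⁻¹ * (Matrix.of fun i j => xRows κ q y₀ 0 i (z j)).det =
        (Matrix.of fun i j : Fin ρ => truncPow ρ (z j - y₀ i)).det := by
      rw [h1]
      refine (congrArg _ (Matrix.det_smul
        (Matrix.of fun i j : Fin ρ => truncPow ρ (z j - y₀ i)) (κ ^ (ρ - 1)))).trans ?_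
      rw [Fintype.card_fin, ← pow_mul, mul_comm (ρ - 1), ← mul_assoc,
        inv_mul_cancel₀ (pow_ne_zero _ hκ.ne'), one_mul]
    rw [h2]
    exact ⟨det_truncPow_nonneg hρ hz hy, rfl⟩
  · intro a i u v
    by_cases hi : (i : ℕ) < ρ
    · rw [show xRows κ q y₀ a i = _ from funext fun t => dif_pos hi]
      exact (intervalIntegrable_truncPow_affine _ _ _ _ _).const_mul _
    · rw [show xRows κ q y₀ a i = _ from funext fun t => dif_neg hi]
      exact (continuous_of_appell hpq.q_zero hpq.hasDerivAt_q _).intervalIntegrable _ _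
  · intro a t
    simp only [xRows, Fin.val_last]
    rw [dif_neg (by omega), show ρ + (a + 1) - 1 - (ρ + a) = 0 by omega, hpq.q_zero]
  · intro a i u v
    rw [Fin.succAbove_last]
    by_cases hi : (i : ℕ) < ρ
    · simp only [xRows, Fin.val_castSucc, dif_pos hi]
      have : κ * ∫ t in u..v, truncPow (ρ + a) (κ * t + -(κ * y₀ ⟨i, hi⟩)) =
          truncPow (ρ + (a + 1)) (κ * v + -(κ * y₀ ⟨i, hi⟩)) -
            truncPow (ρ + (a + 1)) (κ * u + -(κ * y₀ ⟨i, hi⟩)) :=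
        integral_truncPow_affine_of_pos (by omega) κ _ u v
      rw [intervalIntegral.integral_const_mul, pow_succ]
      linear_combination (-(-1) ^ a) * this
    · simp only [xRows, Fin.val_castSucc, dif_neg hi]
      rw [integral_of_appell hpq.q_zero hpq.hasDerivAt_q,
        show ρ + (a + 1) - 1 - (i : ℕ) = ρ + a - 1 - i + 1 by omega]

/-- The last `δ` rows of `xRows` are the last `δ` columns of `appellMatrix q x`. -/
theorem det_xRows {κ : ℝ} {p q : ℕ → ℝ → ℝ} {ρ δ : ℕ} (y₀ : Fin ρ → ℝ) {x : Fin (ρ + δ) → ℝ}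
    (hQ : IsUnit (appellMatrix q x).det) :
    (Matrix.of fun i j => xRows κ q y₀ δ i (x j)).det = (appellMatrix q x).det *
      (Matrix.of fun i j => yRows κ p q x 0 i (y₀ j)).det := by
  rw [det_eq_det_mul_det_of_rows (appellMatrix q x) _ hQ]
  · congr 2
    ext s t
    have ht : (t : ℕ) < ρ := t.2
    simp only [Matrix.of_apply, xRows, yRows, Fin.val_castAdd, dif_pos ht, Nat.not_lt_zero,
      dite_false, zero_add, Finset.mul_sum]
    refine Finset.sum_congr rfl fun l _ => ?_
    rw [mul_left_comm]
    congr 3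
    ring
  · intro i hi j
    simp only [Matrix.of_apply, xRows, dif_neg hi.not_gt, appellMatrix]

/-- Each integration in `y` adds a row of ones in the first position. -/
theorem lintegralChain_yRows {κ : ℝ} (hκ : 0 < κ) {p q : ℕ → ℝ → ℝ} (hpq : AppellPair κ p q)
    {ρ δ : ℕ} {x y : Fin (ρ + δ) → ℝ} {C : ℝ} {g : (Fin ρ → ℝ) → ENNReal}
    (hg : ∀ z, Monotone z → 0 ≤ C * (Matrix.of fun i j => yRows κ p q x 0 i (z j)).det ∧
      g z = ENNReal.ofReal (C * (Matrix.of fun i j => yRows κ p q x 0 i (z j)).det))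
    (hy : Monotone y) :
    0 ≤ C * (κ ^ (∑ i ∈ Finset.range δ, (ρ + i)))⁻¹ *
        (Matrix.of fun i j => yRows κ p q x δ i (y j)).det ∧
      lintegralChain g δ y = ENNReal.ofReal (C * (κ ^ (∑ i ∈ Finset.range δ, (ρ + i)))⁻¹ *
        (Matrix.of fun i j => yRows κ p q x δ i (y j)).det) := by
  refine lintegralChain_det _ hκ.ne' (yRows κ p q x) (fun a => 0) (c := κ)
    (fun a => by simp) hg ?_ ?_ ?_ δ hy
  · intro a i u v
    by_cases hi : (i : ℕ) < a
    · rw [show yRows κ p q x a i = _ from funext fun t => dif_pos hi]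
      exact (continuous_of_appell hpq.p_zero hpq.hasDerivAt_p _).intervalIntegrable _ _
    · rw [show yRows κ p q x a i = _ from funext fun t => dif_neg hi]
      refine IntervalIntegrable.const_mul ?_ _
      have := IntervalIntegrable.sum (μ := volume) (a := u) (b := v) Finset.univ
        (f := fun l t => (appellMatrix q x)⁻¹ ⟨i - a, by omega⟩ l *
          truncPow (ρ + δ + a) (-κ * t + κ * x l))
        (fun l _ => (intervalIntegrable_truncPow_affine _ _ _ _ _).const_mul _)
      refine (congrArg (fun f => IntervalIntegrable f volume u v) (funext fun t => ?_)).mpr this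
      simp
  · intro a t
    simp only [yRows, Fin.val_zero, Nat.succ_pos, dite_true, hpq.p_zero]
  · intro a i u v
    rw [Fin.succAbove_zero]
    by_cases hi : (i : ℕ) < a
    · simp only [yRows, Fin.val_succ, dif_pos hi, dif_pos (Nat.succ_lt_succ hi)]
      exact integral_of_appell hpq.p_zero hpq.hasDerivAt_p _ _ _
    · simp only [yRows, Fin.val_succ, dif_neg hi, dif_neg (show ¬ (i : ℕ) + 1 < a + 1 by omega),
        Nat.add_sub_add_right]
      rw [intervalIntegral.integral_const_mul, intervalIntegral.integral_finsetSum
        fun l _ => (intervalIntegrable_truncPow_affine _ _ _ _ _).const_mul _]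
      rw [← mul_sub, ← Finset.sum_sub_distrib, mul_left_comm, Finset.mul_sum, Finset.mul_sum,
        Finset.mul_sum]
      refine Finset.sum_congr rfl fun l _ => ?_
      have := integral_truncPow_affine_of_pos (show 1 ≤ ρ + δ + a by omega) (-κ) (κ * x l) u v
      rw [intervalIntegral.integral_const_mul, ← add_assoc (ρ + δ) a 1, ← mul_sub, ← this,
        add_right_comm a 1 δ, pow_succ]
      ring

/-- The exponent of `κ` that has accumulated after all integrations. -/
theorem mul_pred_add_sum (ρ δ : ℕ) (hρ : 1 ≤ ρ) :
    (ρ + δ) * (ρ + δ - 1) =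
      ρ * (ρ - 1) + ∑ i ∈ Finset.range δ, (ρ + i) + ∑ i ∈ Finset.range δ, (ρ + i) := by
  obtain ⟨k, rfl⟩ : ∃ k, ρ = k + 1 := ⟨ρ - 1, by omega⟩
  induction δ with
  | zero => simp
  | succ δ ih =>
    rw [Finset.sum_range_succ]
    have h1 : k + 1 + (δ + 1) - 1 = k + δ + 1 := by omega
    have h2 : k + 1 + δ - 1 = k + δ := by omega
    rw [h1]
    rw [h2] at ih
    linarith

/-- The volume of the double cone as a determinant, for distinct `x_i`. -/
theorem volume_cone_eq_det_yRows {κ : ℝ} (hκ : 0 < κ) {p q : ℕ → ℝ → ℝ} (hpq : AppellPair κ p q)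
    {ρ δ : ℕ} (hρ : 1 ≤ ρ) {x y : Fin (ρ + δ) → ℝ} (hx : StrictMono x) (hy : Monotone y)
    (hxy : ρ + δ = 1 → ∀ i j, x i ≠ y j) :
    κ ^ ((ρ + δ) * (ρ + δ - 1)) * volume.real (cone ρ x y) =
      (appellMatrix q x).det * (Matrix.of fun i j => yRows κ p q x δ i (y j)).det := by
  have hQ := hpq.isUnit_det hκ.ne' (show 1 ≤ ρ + δ by omega) hx.injective
  have hmeas : Measurable (Function.uncurry fun x₀ y₀ : Fin ρ → ℝ =>
      ENNReal.ofReal (Matrix.of fun i j => truncPow ρ (x₀ j - y₀ i)).det) := by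
    simp only [Matrix.det_apply', Matrix.of_apply, Function.uncurry_def]
    refine ENNReal.measurable_ofReal.comp (Finset.measurable_fun_sum _ fun σ _ => ?_)
    refine measurable_const.mul (Finset.measurable_fun_prod _ fun i _ => ?_)
    exact (measurable_truncPow ρ).comp (by fun_prop)
  have h := lintegralChain_yRows hκ hpq (x := x) (y := y)
    (C := (κ ^ (ρ * (ρ - 1)))⁻¹ * (κ ^ (∑ i ∈ Finset.range δ, (ρ + i)))⁻¹ * (appellMatrix q x).det)
    (g := fun y₀ => lintegralChain (fun x₀ => ENNReal.ofReal
          (Matrix.of fun i j => truncPow ρ (x₀ j - y₀ i)).det) δ x) (by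
      intro z hz
      have := lintegralChain_xRows hκ hpq hρ hz δ hx.monotone
      rwa [det_xRows (ρ := ρ) (p := p) (κ := κ) z hQ, ← mul_assoc] at this) hy
  rw [Measure.real, volume_cone_eq_lintegralChain hmeas
    (fun x₀ y₀ hx₀ hy₀ h₀ => (volume_cone_self hρ hx₀ hy₀ h₀).2) δ hx.monotone hy hxy,
    h.2, ENNReal.toReal_ofReal h.1, mul_pred_add_sum ρ δ hρ, pow_add, pow_add]
  have := pow_ne_zero (ρ * (ρ - 1)) hκ.ne'
  have := pow_ne_zero (∑ i ∈ Finset.range δ, (ρ + i)) hκ.ne'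
  field_simp

/-- The inverse of `appellMatrix q x` transforms the powers of `κ (t - x_l)` into the functions
`p_{s+δ}`, up to combinations of `p_0, …, p_{δ-1}`. -/
theorem AppellPair.inv_appellMatrix_sum {κ : ℝ} {p q : ℕ → ℝ → ℝ} (hpq : AppellPair κ p q)
    {n : ℕ} (hn : 1 ≤ n) (δ : ℕ) {x : Fin n → ℝ} (hQ : IsUnit (appellMatrix q x).det)
    (s : Fin n) (t : ℝ) :
    ∑ l, (appellMatrix q x)⁻¹ s l *
        ((κ * (t - x l)) ^ (n + δ - 1) / ((n + δ - 1).factorial : ℝ)) =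
      p (s + δ) t + ∑ a ∈ Finset.range δ,
        (∑ l, (appellMatrix q x)⁻¹ s l * q (n + δ - 1 - a) (x l)) * p a t := by
  have h1 : ∀ k : Fin n, ∑ l, (appellMatrix q x)⁻¹ s l * q (n - 1 - k) (x l) =
      (1 : Matrix (Fin n) (Fin n) ℝ) s k := by
    intro k
    rw [← Matrix.nonsing_inv_mul _ hQ, Matrix.mul_apply]
    rfl
  simp only [← hpq.sum_mul, Finset.mul_sum]
  rw [Finset.sum_comm, show n + δ - 1 + 1 = δ + n by omega, Finset.sum_range_add, add_comm]
  congr 1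
  · rw [← Fin.sum_univ_eq_sum_range (fun k => ∑ l, (appellMatrix q x)⁻¹ s l *
      (p (δ + k) t * q (n + δ - 1 - (δ + k)) (x l)))]
    have h2 : ∀ k : Fin n, ∑ l, (appellMatrix q x)⁻¹ s l *
        (p (δ + k) t * q (n + δ - 1 - (δ + k)) (x l)) =
        p (δ + k) t * (1 : Matrix (Fin n) (Fin n) ℝ) s k := by
      intro k
      rw [← h1, Finset.mul_sum, show n + δ - 1 - (δ + (k : ℕ)) = n - 1 - k by omega]
      exact Finset.sum_congr rfl fun l _ => by ring
    simp only [h2, Matrix.one_apply, mul_ite, mul_one, mul_zero, Finset.sum_ite_eq,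
      Finset.mem_univ, if_true]
    rw [add_comm]
  · refine Finset.sum_congr rfl fun a _ => ?_
    rw [Finset.sum_mul]
    exact Finset.sum_congr rfl fun l _ => by ring

theorem sum_fin_ite_lt (ρ δ : ℕ) (F : ℕ → ℝ) :
    (∑ a : Fin (ρ + δ), if (a : ℕ) < δ then F a else 0) = ∑ a ∈ Finset.range δ, F a := by
  rw [Fin.sum_univ_eq_sum_range (fun a => if a < δ then F a else 0), add_comm ρ δ,
    Finset.sum_range_add]
  simp only [add_lt_iff_neg_left, Nat.not_lt_zero, if_false, Finset.sum_const_zero, add_zero]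
  exact Finset.sum_congr rfl fun a ha => if_pos (Finset.mem_range.1 ha)

/-- The volume of the double cone for distinct `x_i`, in terms of an arbitrary Appell pair. -/
theorem volume_cone_eq_det_appell {κ : ℝ} (hκ : 0 < κ) {p q : ℕ → ℝ → ℝ} (hpq : AppellPair κ p q)
    {ρ δ : ℕ} (hρ : 1 ≤ ρ) {x y : Fin (ρ + δ) → ℝ} (hx : StrictMono x) (hy : Monotone y)
    (hxy : ρ + δ = 1 → ∀ i j, x i ≠ y j) :
    κ ^ ((ρ + δ) * (ρ + δ - 1)) * volume.real (cone ρ x y) =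
      (appellMatrix q x).det * (Matrix.of fun i j : Fin (ρ + δ) => p i (y j) +
        if δ ≤ (i : ℕ) then -∑ l, (appellMatrix q x)⁻¹
          ⟨(i : ℕ) - δ, (Nat.sub_le _ _).trans_lt i.isLt⟩ l *
            heaviside (ρ + δ + δ) (κ * (y j - x l)) else 0).det := by
  have hQ := hpq.isUnit_det hκ.ne' (show 1 ≤ ρ + δ by omega) hx.injective
  rw [volume_cone_eq_det_yRows hκ hpq hρ hx hy hxy]
  congr 1
  -- The sign comes from `pow_sub_heaviside`, once for each of the last `ρ` rows.
  have hw : (((-1 : ℝ) ^ (ρ + δ + δ - 1)) ^ ρ) = 1 := by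
    rw [← pow_mul]
    refine Even.neg_one_pow ?_
    obtain ⟨k, rfl⟩ : ∃ k, ρ = k + 1 := ⟨ρ - 1, by omega⟩
    rw [show k + 1 + δ + δ - 1 = k + 2 * δ by omega, Nat.even_mul]
    rcases Nat.even_or_odd k with h | h
    · exact Or.inl (h.add (even_two_mul δ))
    · exact Or.inr h.add_one
  refine (((det_eq_of_rows_add (B := Matrix.of fun i j => yRows κ p q x δ i (y j))
    ((-1) ^ (ρ + δ + δ - 1))
    (fun i a => -∑ l, (appellMatrix q x)⁻¹ ⟨(i : ℕ) - δ, (Nat.sub_le _ _).trans_lt i.isLt⟩ l *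
      q (ρ + δ + δ - 1 - a) (x l)) ?_ ?_).trans ?_)).symm
  · intro i hi j
    simp [yRows, hi, hi.not_ge]
  · intro i hi j
    have h1 := hpq.inv_appellMatrix_sum (show 1 ≤ ρ + δ by omega) δ hQ
      ⟨(i : ℕ) - δ, (Nat.sub_le _ _).trans_lt i.isLt⟩ (y j)
    have h2 : ∀ l, (κ * (y j - x l)) ^ (ρ + δ + δ - 1) / ((ρ + δ + δ - 1).factorial : ℝ) =
        heaviside (ρ + δ + δ) (κ * (y j - x l)) +
          (-1) ^ (ρ + δ + δ - 1) * truncPow (ρ + δ + δ) (-κ * y j + κ * x l) := by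
      intro l
      rw [← sub_eq_iff_eq_add', pow_sub_heaviside]
      congr 2
      ring
    have h3 : (∑ a : Fin (ρ + δ), if (a : ℕ) < δ then
        (-∑ l, (appellMatrix q x)⁻¹ ⟨(i : ℕ) - δ, (Nat.sub_le _ _).trans_lt i.isLt⟩ l *
          q (ρ + δ + δ - 1 - a) (x l)) * (Matrix.of fun i j => yRows κ p q x δ i (y j)) a j else 0) =
        -∑ a ∈ Finset.range δ, (∑ l, (appellMatrix q x)⁻¹
          ⟨(i : ℕ) - δ, (Nat.sub_le _ _).trans_lt i.isLt⟩ l *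
            q (ρ + δ + δ - 1 - a) (x l)) * p a (y j) := by
      rw [← Finset.sum_neg_distrib, ← sum_fin_ite_lt ρ δ]
      refine Finset.sum_congr rfl fun a _ => ?_
      split_ifs with ha
      · simp [yRows, ha]
      · rfl
    rw [h3]
    simp only [h2, mul_add, Finset.sum_add_distrib] at h1
    simp only [Matrix.of_apply, if_pos hi, yRows, dif_neg hi.not_gt, Even.neg_one_pow ⟨δ, rfl⟩,
      one_mul]
    rw [Nat.sub_add_cancel hi] at h1
    rw [Finset.mul_sum]
    simp only [mul_left_comm _ ((-1 : ℝ) ^ (ρ + δ + δ - 1))] at h1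
    linarith
  · rw [hw, one_mul]

/-! ### Hermite polynomials and powers as Appell pairs -/

theorem derivative_hermiteH (m : ℕ) :
    derivative (hermiteH (m + 1)) = 2 * ((m : ℤ[X]) + 1) * hermiteH m := by
  have h2 : derivative (2 : ℤ[X]) = 0 := derivative_ofNat 2
  induction m with
  | zero => simp [hermiteH, h2]
  | succ m ih =>
    rw [hermiteH, ih]
    have h3 : derivative (2 * ((m : ℤ[X]) + 1)) = 0 := by simp [derivative_mul, h2]
    rw [derivative_sub, derivative_mul, derivative_mul, derivative_mul, h2, h3, derivative_X, ih]
    have h4 : derivative (hermiteH m) = 2 * X * hermiteH m - hermiteH (m + 1) := by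
      rw [hermiteH]; ring
    rw [h4]
    push_cast
    ring

theorem hermiteT_succ_succ {K : Type*} [Field K] [CharZero K] (m : ℕ) (z : K) :
    ((m : K) + 2) * hermiteT (m + 2) z = 2 * z * hermiteT (m + 1) z - 2 * hermiteT m z := by
  have h1 : hermiteH (m + 2) = 2 * X * hermiteH (m + 1) - 2 * ((m : ℤ[X]) + 1) * hermiteH m := by
    rw [← derivative_hermiteH]
    rfl
  have h2 : (m.factorial : K) ≠ 0 := Nat.cast_ne_zero.2 m.factorial_ne_zero
  have h3 : (m : K) + 1 ≠ 0 := by exact_mod_cast m.succ_ne_zero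
  have h4 : (m : K) + 2 ≠ 0 := by exact_mod_cast (m + 1).succ_ne_zero
  simp only [hermiteT, h1, Nat.factorial_succ, map_sub, map_mul, map_add, aeval_X, map_natCast,
    map_ofNat, map_one]
  push_cast
  rw [show (m : K) + 1 + 1 = m + 2 by ring]
  field_simp

/-- The three-term recurrence of the rescaled Hermite polynomials at the point `u`, for `s = -1`;
the opposite sign occurs after rotation of the argument by `i`. -/
structure HermiteRec (s u : ℝ) (f : ℕ → ℝ) : Prop where
  zero : f 0 = 1
  one : f 1 = 2 * u
  succ_succ : ∀ m : ℕ, ((m : ℝ) + 2) * f (m + 2) = 2 * u * f (m + 1) + 2 * s * f m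

theorem hermiteT_rec (u : ℝ) : HermiteRec (-1) u fun m => hermiteT m u where
  zero := by simp [hermiteT, hermiteH]
  one := by
    have h : aeval u (2 : ℤ[X]) = 2 := map_ofNat _ 2
    simp [hermiteT, hermiteH, h]
  succ_succ m := by rw [hermiteT_succ_succ]; ring

theorem hermiteP_rec (u : ℝ) : HermiteRec 1 u fun m => hermiteP m u where
  zero := by simp [hermiteP, hermiteT, hermiteH]
  one := by
    have h : hermiteT 1 (Complex.I * (u : ℂ)) / Complex.I ^ 1 = ((2 * u : ℝ) : ℂ) := by
      have h2 : aeval (Complex.I * (u : ℂ)) (2 : ℤ[X]) = 2 := map_ofNat _ 2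
      have hI := Complex.I_ne_zero
      simp only [hermiteT, hermiteH, derivative_one, mul_one, sub_zero, map_mul, h2, aeval_X,
        Nat.factorial_one, Nat.cast_one, div_one, pow_one, Complex.ofReal_mul, Complex.ofReal_ofNat]
      field_simp
    rw [hermiteP, h, Complex.ofReal_re]
  succ_succ m := by
    have h := hermiteT_succ_succ m (Complex.I * (u : ℂ))
    have hI : Complex.I ^ m ≠ 0 := pow_ne_zero _ Complex.I_ne_zero
    have hII : Complex.I ^ 2 = -1 := Complex.I_sq
    have e1 : hermiteT (m + 1) (Complex.I * (u : ℂ)) / Complex.I ^ (m + 1) =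
        -(Complex.I * hermiteT (m + 1) (Complex.I * (u : ℂ))) / Complex.I ^ m := by
      rw [pow_succ, div_eq_div_iff (mul_ne_zero hI Complex.I_ne_zero) hI]
      linear_combination (hermiteT (m + 1) (Complex.I * (u : ℂ)) * Complex.I ^ m) * hII
    have e2 : hermiteT (m + 2) (Complex.I * (u : ℂ)) / Complex.I ^ (m + 2) =
        -hermiteT (m + 2) (Complex.I * (u : ℂ)) / Complex.I ^ m := by
      rw [pow_add, hII, mul_neg_one, div_neg, neg_div]
    have key : (((m : ℝ) + 2) * hermiteP (m + 2) u : ℂ) =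
        ((2 * u * hermiteP (m + 1) u + 2 * 1 * hermiteP m u : ℝ) : ℂ) := by
      push_cast
      rw [ofReal_hermiteP, ofReal_hermiteP, ofReal_hermiteP, e1, e2]
      linear_combination (-1 / Complex.I ^ m) * h
    exact_mod_cast key

theorem HermiteRec.hasDerivAt {s : ℝ} {f : ℕ → ℝ → ℝ} (h : ∀ u, HermiteRec s u fun m => f m u)
    (m : ℕ) (u : ℝ) : HasDerivAt (f (m + 1)) (2 * f m u) u := by
  induction m using Nat.strong_induction_on generalizing u with
  | _ m ih =>
    rcases m with _ | m
    · have : f (0 + 1) = fun u => 2 * u := funext fun u => (h u).one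
      rw [this, (h u).zero]
      exact (hasDerivAt_id u).const_mul 2
    · have h4 : (m : ℝ) + 2 ≠ 0 := by positivity
      have h0 : f (m + 1 + 1) = fun u => ((m : ℝ) + 2)⁻¹ * (2 * u * f (m + 1) u + 2 * s * f m u) :=
        funext fun u => by
          rw [← (h u).succ_succ m]
          field_simp
      have h1 := ih m (Nat.lt_succ_self m) u
      have h2 : HasDerivAt (fun u => 2 * s * f m u)
          (2 * ((m : ℝ) + 1) * f (m + 1) u - 2 * u * (2 * f m u)) u := by
        rcases m with _ | m
        · have : f 0 = fun _ => 1 := funext fun u => (h u).zero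
          rw [this, (h u).one]
          refine (hasDerivAt_const u _).congr_deriv ?_
          push_cast
          ring
        · refine ((ih m (by omega) u).const_mul (2 * s)).congr_deriv ?_
          have := (h u).succ_succ m
          push_cast
          linear_combination (-2 : ℝ) * this
      rw [h0]
      refine ((((hasDerivAt_id u).const_mul 2).mul h1).add h2 |>.const_mul _).congr_deriv ?_
      simp only [id]
      field_simp
      ring

/-- Product of the generating functions: the quadratic terms in the exponents of
`exp (2 u w + s w ^ 2)` and `exp (2 v w - s w ^ 2)` cancel. -/
theorem HermiteRec.sum_mul {s u v : ℝ} {f g : ℕ → ℝ} (hf : HermiteRec s u f)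
    (hg : HermiteRec (-s) v g) (m : ℕ) :
    ∑ a ∈ Finset.range (m + 1), f a * g (m - a) = (2 * (u + v)) ^ m / (m.factorial : ℝ) := by
  have hder : ∀ {s u : ℝ} {f : ℕ → ℝ}, HermiteRec s u f →
      PowerSeries.derivative ℝ (PowerSeries.mk f) =
        (PowerSeries.C (2 * u) + PowerSeries.C (2 * s) * PowerSeries.X) * PowerSeries.mk f := by
    intro s u f h
    ext n
    rw [PowerSeries.coeff_derivative, add_mul, map_add, PowerSeries.coeff_C_mul,
      mul_assoc (PowerSeries.C (2 * s)), PowerSeries.coeff_C_mul]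
    rcases n with _ | n
    · simp [h.zero, h.one]
    · rw [PowerSeries.coeff_succ_X_mul]
      simp only [PowerSeries.coeff_mk]
      have := h.succ_succ n
      push_cast
      linear_combination this
  set S := PowerSeries.mk f * PowerSeries.mk g with hS
  have hdS : PowerSeries.derivative ℝ S = PowerSeries.C (2 * (u + v)) * S := by
    rw [hS, Derivation.leibniz, hder hf, hder hg]
    simp only [smul_eq_mul, map_mul, map_add, map_neg]
    ring
  have hcoeff : ∀ m, PowerSeries.coeff m S = (2 * (u + v)) ^ m / (m.factorial : ℝ) := by
    intro m
    induction m with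
    | zero => simp [hS, hf.zero, hg.zero]
    | succ m ih =>
      have h1 := congrArg (PowerSeries.coeff m) hdS
      rw [PowerSeries.coeff_derivative, PowerSeries.coeff_C_mul, ih] at h1
      have h3 : (m : ℝ) + 1 ≠ 0 := by positivity
      rw [Nat.factorial_succ, pow_succ]
      push_cast
      field_simp at h1 ⊢
      linear_combination h1
  rw [← hcoeff m, hS, PowerSeries.coeff_mul, Finset.Nat.sum_antidiagonal_eq_sum_range_succ_mk]
  simp

theorem appellPair_hermite (β : ℝ) :
    AppellPair 2 (fun m y => hermiteP m (y - β)) (fun m x => hermiteT m (-(x - β))) where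
  p_zero t := (hermiteP_rec _).zero
  q_zero t := (hermiteT_rec _).zero
  hasDerivAt_p m t := (HermiteRec.hasDerivAt hermiteP_rec m (t - β)).comp_sub_const t β
  hasDerivAt_q m t := by
    refine ((HermiteRec.hasDerivAt hermiteT_rec m (-(t - β))).comp t
      (((hasDerivAt_id t).sub_const β).neg)).congr_deriv ?_
    ring
  sum_mul m x y := by
    rw [(hermiteP_rec (y - β)).sum_mul (hermiteT_rec (-(x - β))) m]
    congr 3
    ring

theorem appellPair_pow (β : ℝ) :
    AppellPair 1 (fun m y => (y - β) ^ m / (m.factorial : ℝ))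
      (fun m x => (-(x - β)) ^ m / (m.factorial : ℝ)) where
  p_zero t := by simp
  q_zero t := by simp
  hasDerivAt_p m t := by
    refine ((((hasDerivAt_id t).sub_const β).pow (m + 1)).div_const
      ((m + 1).factorial : ℝ)).congr_deriv ?_
    have h3 : (m : ℝ) + 1 ≠ 0 := by positivity
    have h2 : (m.factorial : ℝ) ≠ 0 := Nat.cast_ne_zero.2 m.factorial_ne_zero
    rw [Nat.factorial_succ]
    push_cast
    simp only [id]
    field_simp
  hasDerivAt_q m t := by
    refine (((((hasDerivAt_id t).sub_const β).neg).pow (m + 1)).div_const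
      ((m + 1).factorial : ℝ)).congr_deriv ?_
    have h3 : (m : ℝ) + 1 ≠ 0 := by positivity
    have h2 : (m.factorial : ℝ) ≠ 0 := Nat.cast_ne_zero.2 m.factorial_ne_zero
    rw [Nat.factorial_succ]
    push_cast
    simp only [id, Pi.neg_apply]
    field_simp
  sum_mul m x y := by
    rw [one_mul, show y - x = (y - β) + -(x - β) by ring, add_pow, Finset.sum_div]
    refine Finset.sum_congr rfl fun a ha => ?_
    have ha : a ≤ m := Nat.lt_succ_iff.1 (Finset.mem_range.1 ha)
    rw [Nat.cast_choose ℝ ha]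
    have h1 : (m.factorial : ℝ) ≠ 0 := Nat.cast_ne_zero.2 m.factorial_ne_zero
    field_simp

/-- Cramer's rule. -/
theorem cramerF_eq {n : ℕ} (δ : ℕ) (x : Fin n → ℝ) (y : ℝ) (k : Fin n) :
    cramerF δ x y k =
      -∑ l, (hermiteMatrix x)⁻¹ k l * heaviside (n + δ) (2 * (y - x l)) := by
  rw [cramerF, ← Matrix.cramer_apply, Matrix.cramer_eq_adjugate_mulVec, Matrix.inv_def,
    Ring.inverse_eq_inv', Matrix.mulVec, dotProduct, neg_mul, Finset.mul_sum]
  congr 1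
  exact Finset.sum_congr rfl fun l _ => (mul_assoc _ _ _).symm

theorem volume_cone_eq_gammaH {ρ δ : ℕ} (hρ : 1 ≤ ρ) {x y : Fin (ρ + δ) → ℝ} (hx : StrictMono x)
    (hy : Monotone y) (hxy : ρ + δ = 1 → ∀ i j, x i ≠ y j) (β : ℝ) :
    volume.real (cone ρ x y) = gammaH δ β x y := by
  have h := volume_cone_eq_det_appell (by norm_num) (appellPair_hermite β) hρ hx hy hxy
  have hQ : appellMatrix (fun m x => hermiteT m (-(x - β))) x = hermiteMatrix fun i => x i - β := rfl
  rw [hQ] at h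
  rw [gammaH, div_mul_eq_mul_div, eq_div_iff (by positivity), mul_comm, h]
  simp only [cramerF_eq, sub_sub_sub_cancel_right]

theorem iterate_derivative_X_sub_C_mul_eval (a : ℝ) (f : ℝ[X]) (d : ℕ) :
    (derivative^[d] ((X - C a) * f)).eval a = d * (derivative^[d - 1] f).eval a := by
  have h : derivative^[d] ((X - C a) * f) =
      (X - C a) * derivative^[d] f + (d : ℝ[X]) * derivative^[d - 1] f := by
    induction d with
    | zero => simp
    | succ d ih =>
      rw [Function.iterate_succ_apply', ih]
      rcases d with _ | d
      · simp [derivative_mul]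
        ring
      · simp only [derivative_add, derivative_mul, derivative_sub, derivative_X, derivative_C,
          derivative_natCast, Nat.add_sub_cancel, ← Function.iterate_succ_apply' derivative]
        push_cast
        ring
  simp [h]

theorem polyR_eq_nodal {n : ℕ} (β : ℝ) (x : Fin n → ℝ) :
    polyR β x = Lagrange.nodal Finset.univ fun k => x k - β := by
  simp only [polyR, Lagrange.nodal, map_sub]
  exact Finset.prod_congr rfl fun k _ => by ring

/-- The matrix `ℒ` is the matrix of `(-d/dz)^δ` in the Lagrange basis. -/
theorem matL_eq {n : ℕ} (δ : ℕ) (β : ℝ) (x : Fin n → ℝ)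
    (i k : Fin n) :
    matL δ β x i k = (-1) ^ δ *
      (derivative^[δ] (Lagrange.basis Finset.univ (fun k => x k - β) k)).eval (x i - β) := by
  set ξ : Fin n → ℝ := fun k => x k - β with hξ
  have hb : Lagrange.basis Finset.univ ξ k =
      C ((derivative (polyR β x)).eval (ξ k))⁻¹ * Lagrange.nodal (Finset.univ.erase k) ξ := by
    rw [Lagrange.basis_eq_prod_sub_inv_mul_nodal_div (Finset.mem_univ k),
      Lagrange.nodalWeight_eq_eval_derivative_nodal (Finset.mem_univ k),
      ← Lagrange.nodal_erase_eq_nodal_div (Finset.mem_univ k), polyR_eq_nodal]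
  rw [hb, iterate_derivative_C_mul, eval_C_mul, matL, Matrix.of_apply]
  split_ifs with hik
  · subst hik
    have h1 : polyR β x = (X - C (x i - β)) * Lagrange.nodal (Finset.univ.erase i) ξ := by
      rw [polyR_eq_nodal, Lagrange.nodal_eq_mul_nodal_erase (Finset.mem_univ i)]
    have h2 : (derivative^[δ + 1] (polyR β x)).eval (x i - β) =
        ((δ : ℝ) + 1) * (derivative^[δ] (Lagrange.nodal (Finset.univ.erase i) ξ)).eval (x i - β) := by
      rw [h1, iterate_derivative_X_sub_C_mul_eval]
      simp
    have h3 : (δ : ℝ) + 1 ≠ 0 := by positivity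
    rw [h2]
    simp only [hξ]
    field_simp
  · have h1 : Lagrange.nodal (Finset.univ.erase k) ξ = (X - C (x i - β)) * polyRhat β x i k := by
      rw [Lagrange.nodal_eq_mul_nodal_erase (show i ∈ Finset.univ.erase k by simp [hik])]
      congr 1
      rw [polyRhat, Lagrange.nodal]
      refine Finset.prod_congr ?_ fun l _ => ?_
      · ext l
        simp
      · simp only [hξ, map_sub]
        ring
    rw [h1, iterate_derivative_X_sub_C_mul_eval]
    simp only [hξ]
    ring

/-- On polynomials of degree less than `n`, evaluated at the points `x_k`, the matrix `ℒ` acts as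
`(-d/dz)^δ`. -/
theorem sum_matL_mul {n : ℕ} (δ : ℕ) (β : ℝ) {x : Fin n → ℝ} (hx : Function.Injective x)
    (i : Fin n) {m : ℕ} (hm : m < n) :
    ∑ k, matL δ β x i k * ((-(x k - β)) ^ m / (m.factorial : ℝ)) =
      if δ ≤ m then (-(x i - β)) ^ (m - δ) / ((m - δ).factorial : ℝ) else 0 := by
  set ξ : Fin n → ℝ := fun k => x k - β with hξ
  have hinj : Set.InjOn ξ (Finset.univ : Finset (Fin n)) := fun a _ b _ hab => hx (by
    simpa [hξ] using hab)
  set f : ℝ[X] := C ((-1) ^ m / (m.factorial : ℝ)) * X ^ m with hf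
  have hfe : ∀ t, f.eval t = (-t) ^ m / (m.factorial : ℝ) := fun t => by
    rw [hf, neg_pow t]
    simp
    ring
  have hdeg : f.degree < (Finset.univ : Finset (Fin n)).card := by
    refine (degree_C_mul_X_pow_le _ _).trans_lt ?_
    simpa using hm
  have h1 := congrArg (fun g : ℝ[X] => (-1) ^ δ * (derivative^[δ] g).eval (ξ i))
    (Lagrange.eq_interpolate hinj hdeg)
  simp only [Lagrange.interpolate_apply, iterate_derivative_sum, iterate_derivative_C_mul,
    eval_finsetSum, eval_C_mul, hfe] at h1
  have h2 : ∑ k, matL δ β x i k * ((-(x k - β)) ^ m / (m.factorial : ℝ)) =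
      (-1) ^ δ * (derivative^[δ] f).eval (ξ i) := by
    rw [h1, Finset.mul_sum]
    refine Finset.sum_congr rfl fun k _ => ?_
    rw [matL_eq]
    simp only [hξ]
    ring
  rw [h2, hf, iterate_derivative_C_mul, iterate_derivative_X_pow_eq_C_mul, eval_C_mul, eval_C_mul,
    eval_pow, eval_X]
  split_ifs with hδ
  · obtain ⟨l, rfl⟩ := Nat.exists_eq_add_of_le hδ
    have h4 : ((δ + l).factorial : ℝ) ≠ 0 := Nat.cast_ne_zero.2 (δ + l).factorial_ne_zero
    have h5 : (l.factorial : ℝ) ≠ 0 := Nat.cast_ne_zero.2 l.factorial_ne_zero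
    have h3 : (l.factorial : ℝ) * ((δ + l).descFactorial δ : ℝ) = ((δ + l).factorial : ℝ) := by
      have := Nat.factorial_mul_descFactorial hδ
      rw [Nat.add_sub_cancel_left] at this
      exact_mod_cast this
    have h6 : ((-1 : ℝ) ^ δ) * (-1) ^ δ = 1 := by rw [← mul_pow]; simp
    rw [Nat.add_sub_cancel_left, neg_pow (x i - β) l, pow_add, ← h3]
    have h7 : ((δ + l).descFactorial δ : ℝ) ≠ 0 := right_ne_zero_of_mul (h3 ▸ h4)
    field_simp
    simp only [hξ]
    linear_combination ((x i - β) ^ l) * h6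
  · rw [Nat.descFactorial_eq_zero_iff_lt.2 (not_le.1 hδ)]
    simp

/-- In the basis of the normalized powers, ordered by decreasing degree, `(-d/dz)^δ` is a shift. -/
theorem matL_eq_mul {n : ℕ} (hn : 1 ≤ n) (δ : ℕ) (β : ℝ) {x : Fin n → ℝ}
    (hx : Function.Injective x) :
    matL δ β x = appellMatrix (fun m x => (-(x - β)) ^ m / (m.factorial : ℝ)) x *
      Matrix.of fun (k l : Fin n) => if δ ≤ (k : ℕ) then
        (appellMatrix (fun m x => (-(x - β)) ^ m / (m.factorial : ℝ)) x)⁻¹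
          ⟨(k : ℕ) - δ, (Nat.sub_le _ _).trans_lt k.isLt⟩ l else 0 := by
  have hQ := (appellPair_pow β).isUnit_det one_ne_zero hn hx
  set Q := appellMatrix (fun m x => (-(x - β)) ^ m / (m.factorial : ℝ)) x with hQdef
  set T : Matrix (Fin n) (Fin n) ℝ := Matrix.of fun (k l : Fin n) => if δ ≤ (k : ℕ) then
    Q⁻¹ ⟨(k : ℕ) - δ, (Nat.sub_le _ _).trans_lt k.isLt⟩ l else 0 with hT
  have hTQ : ∀ k b : Fin n, (T * Q) k b = if (k : ℕ) = b + δ then 1 else 0 := by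
    intro k b
    rw [Matrix.mul_apply]
    by_cases hk : δ ≤ (k : ℕ)
    · simp only [hT, Matrix.of_apply, if_pos hk]
      rw [← Matrix.mul_apply, Matrix.nonsing_inv_mul _ hQ, Matrix.one_apply]
      refine if_congr ?_ rfl rfl
      rw [Fin.ext_iff]
      dsimp only
      omega
    · simp only [hT, Matrix.of_apply, if_neg hk, zero_mul, Finset.sum_const_zero]
      rw [if_neg (by omega)]
  -- On both sides, column `b` is column `b + δ` of `Q`, or `0` if `b + δ ≥ n`.
  have hLQ : matL δ β x * Q = (Q * T) * Q := by
    ext i b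
    rw [Matrix.mul_assoc, Matrix.mul_apply, Matrix.mul_apply]
    simp only [hTQ]
    refine (sum_matL_mul δ β hx i (show n - 1 - (b : ℕ) < n by omega)).trans ?_
    split_ifs with hb
    · rw [Finset.sum_eq_single ⟨b + δ, by omega⟩]
      · simp only [if_true, mul_one, hQdef, appellMatrix, Matrix.of_apply]
        rw [Nat.sub_sub _ (b : ℕ) δ]
      · intro k _ hk
        rw [if_neg (fun h => hk (Fin.ext h)), mul_zero]
      · simp
    · refine (Finset.sum_eq_zero fun k _ => ?_).symm
      rw [if_neg (by omega), mul_zero]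
  have := congrArg (fun M => M * Q⁻¹) hLQ
  simpa only [Matrix.mul_assoc, Matrix.mul_nonsing_inv _ hQ, Matrix.mul_one] using this

theorem volume_cone_eq_gammaL {ρ δ : ℕ} (hρ : 1 ≤ ρ) {x y : Fin (ρ + δ) → ℝ} (hx : StrictMono x)
    (hy : Monotone y) (hxy : ρ + δ = 1 → ∀ i j, x i ≠ y j) (β : ℝ) :
    volume.real (cone ρ x y) = gammaL δ β x y := by
  have h := volume_cone_eq_det_appell one_pos (appellPair_pow β) hρ hx hy hxy
  rw [one_pow, one_mul, ← Matrix.det_mul] at h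
  rw [h, gammaL]
  congr 1
  ext i j
  rw [Matrix.mul_apply, Matrix.of_apply, matL_eq_mul (by omega) δ β hx.injective]
  simp only [Matrix.of_apply, mul_add, Finset.sum_add_distrib, sub_eq_add_neg]
  congr 1
  · obtain ⟨n, hn⟩ : ∃ n, ρ + δ = n + 1 := ⟨ρ + δ - 1, by omega⟩
    clear h hxy hρ
    revert x y i j
    rw [hn]
    intro x y hx hy i j
    have := (appellPair_pow β).sum_appellMatrix x i (y j)
    rw [one_mul] at this
    simpa [sub_eq_add_neg] using this
  · simp only [Matrix.mul_apply, Matrix.of_apply, Finset.sum_mul]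
    rw [Finset.sum_comm, ← Finset.sum_neg_distrib]
    refine Finset.sum_congr rfl fun k _ => ?_
    split_ifs with hk
    · rw [mul_neg, Finset.mul_sum]
      congr 1
      exact Finset.sum_congr rfl fun l _ => by simp only [one_mul, mul_assoc]
    · simp

end DoubleCone

end

theorem proposition7p1 (n ρ δ : ℕ) (hρ : 1 ≤ ρ) (hn : n = ρ + δ)
    (x y : Fin n → ℝ) (hx : Monotone x) (hy : Monotone y)
    (hxy : n = 1 → ∀ i j, x i ≠ y j) :
    MeasureTheory.volume (DoubleCone.cone ρ x y) < ⊤ ∧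
    (n = ρ →
      MeasureTheory.volume.real (DoubleCone.cone ρ x y) =
        (Matrix.of fun i j : Fin n =>
          if y j < x i then (x i - y j) ^ (n - 1) / ((n - 1).factorial : ℝ) else 0).det) ∧
    (StrictMono x → ∀ β : ℝ,
      MeasureTheory.volume.real (DoubleCone.cone ρ x y) = DoubleCone.gammaL δ β x y ∧
      MeasureTheory.volume.real (DoubleCone.cone ρ x y) = DoubleCone.gammaH δ β x y) := by
  refine ⟨?_, ?_, ?_⟩
  · obtain ⟨k, rfl⟩ : ∃ k, n = k + 1 := ⟨n - 1, by omega⟩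
    exact DoubleCone.volume_cone_lt_top ρ hx hy
  · rintro rfl
    have h := DoubleCone.volume_cone_self hρ hx hy hxy
    rw [Measure.real, h.2, ENNReal.toReal_ofReal h.1, ← Matrix.det_transpose]
    congr 1
    ext i j
    simp [DoubleCone.truncPow]
  · subst hn
    exact fun hxs β => ⟨DoubleCone.volume_cone_eq_gammaL hρ hxs hy hxy β,
      DoubleCone.volume_cone_eq_gammaH hρ hxs hy hxy β⟩
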